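/- **Definitions.** For an odd integer $m\ge 1$ and $t\in\mathbb C$ with $\operatorname{Re}t>0$ let $$J_m(w,t)=\int_0^\infty (x^2+t^2)^{-w}x^m\tanh(\pi x)\,dx,\qquad (x^2+t^2)^{-w}=\exp(-w\log(x^2+t^2))$$ (principal logarithm) for $\operatorname{Re}w>\frac{m+1}{2}$, and denote by the same symbol its meromorphic continuation in $w$ to $\mathbb C$. For an integer $r\ge1$ and $\operatorname{Re}s>\frac12$ put, with $t=s-\frac12$, $$\phi_r(s)=\prod_{\ell=0}^{r-1}\exp\Bigl(-\frac{\partial}{\partial w}J_{2\ell+1}(w,t)\Big|_{w=0}\Bigr)^{2\binom{r-1}{\ell}t^{2(r-1-\ell)}}.$$ Let $\zeta(w,z)$ be the Hurwitz zeta function, that is, the meromorphic continuation in $w$ to $\mathbb C$ of $\sum_{n\ge0}(n+z)^{-w}$ ($\operatorname{Re}w>1$), and let $\mathfrak G_k(z)=\exp\bigl(\frac{\partial}{\partial w}\zeta(w,z)|_{w=1-k}\bigr)$ be the Milnor gamma function of depth $k\ge 1$. A power $\exp(a)^b$ of one of these exponentials means $\exp(ab)$; in particular the powers of $\mathfrak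 G_k(z)$ are formed with $\log\mathfrak G_k(z)=\frac{\partial}{\partial w}\zeta(w,z)|_{w=1-k}$. **Proposition.** Let $r\ge1$ be an integer. For every $s\in\mathbb C$ with $\operatorname{Re}s>\frac12$, the integrals for $J_{2\ell+1}(w,s-\frac12)$, $0\le\ell\le r-1$, converge absolutely for $\operatorname{Re}w>\ell+1$ and have meromorphic continuations to $w\in\mathbb C$ that are holomorphic at $w=0$; the series for $\zeta(w,s)$ converges absolutely for $\operatorname{Re}w>1$ and has a meromorphic continuation to $w\in\mathbb C$ that is holomorphic at $w=1-k$ for $r\le k\le 2r$; and $$\phi_r(s)=e^{-\frac{(2r)!!}{r^2(2r-1)!!}(s-\frac12)^{2r}}\prod_{k=r}^{2r}\mathfrak G_k(s)^{\binom{r}{k-r}\frac{2k}{r}(-1)^{k+r-1}(2s-1)^{2r-k}}.$$ The identity persists under analytic continuation: if $\Omega\supseteq\{\operatorname{Re}s>\frac12\}$ is open and connected, and $\phi_r$ and $\log\mathfrak G_k$ ($r\le k\le 2r$) extend holomorphically from the half-plane $\operatorname{Re}s>\frac12$ to $\Omega$, then it holds for the extensions on all of $\Omega$. -/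

import Mathlib

open scoped BigOperators

noncomputable section

/-- `F` is the meromorphic continuation to the whole plane of a function `f` given on the half plane
`Re w > σ`. Normal form means that `F` is analytic at each point where it has no pole (removable
singularities are filled in), and has the value `0` at each pole; so `F` is unique. -/
def IsMeromorphicContinuation (f : ℂ → ℂ) (σ : ℝ) (F : ℂ → ℂ) : Prop :=
  MeromorphicNFOn F Set.univ ∧ ∀ w : ℂ, σ < w.re → F w = f w

open Classical in
/-- The meromorphic continuation of `f` from the half plane `Re w > σ` to the whole plane
(with the value `0` everywhere if there is none). -/
def meromorphicContinuation (f : ℂ → ℂ) (σ : ℝ) : ℂ → ℂ :=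
  if h : ∃ F : ℂ → ℂ, IsMeromorphicContinuation f σ F then h.choose else fun _ => 0

/-- The integrand `(x² + t²)^(-w) x^m tanh (π x)`, where
`(x² + t²)^(-w) = exp (-w log (x² + t²))` with the principal branch of the logarithm. -/
def momentIntegrand (m : ℕ) (w t : ℂ) (x : ℝ) : ℂ :=
  Complex.exp (-w * Complex.log ((x : ℂ) ^ 2 + t ^ 2)) * (x : ℂ) ^ m *
    (Real.tanh (Real.pi * x) : ℂ)

/-- The integral over `(0, ∞)` of the integrand above; it converges for `Re w > (m + 1) / 2`. -/
def momentIntegral (m : ℕ) (w t : ℂ) : ℂ :=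
  ∫ x in Set.Ioi (0 : ℝ), momentIntegrand m w t x

/-- The moment function `J_m(w, t)`, as a meromorphic function of `w` on the whole plane. -/
def momentFunction (m : ℕ) (w t : ℂ) : ℂ :=
  meromorphicContinuation (fun w' => momentIntegral m w' t) (((m : ℝ) + 1) / 2) w

/-- The power `(exp a) ^ b` of an exponential, `exp (b a)`: the branch of the power is the one for
which `a` is the logarithm of `exp a`. -/
def expPow (a b : ℂ) : ℂ := Complex.exp (b * a)

/-- The gamma factor
`φ_r(s) = ∏_{ℓ < r} exp (-∂J_{2ℓ+1}(w, t)/∂w |_{w = 0}) ^ (2 (r-1 choose ℓ) t^(2(r-1-ℓ)))`,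
where `t = s - 1/2`. -/
def gammaFactor (r : ℕ) (s : ℂ) : ℂ :=
  ∏ ℓ ∈ Finset.range r,
    expPow (-deriv (fun w => momentFunction (2 * ℓ + 1) w (s - 1 / 2)) 0)
      (2 * ((r - 1).choose ℓ : ℂ) * (s - 1 / 2) ^ (2 * (r - 1 - ℓ)))

/-- The Dirichlet series `∑_{n ≥ 0} (n + z)^(-w)`; it converges for `Re w > 1`. -/
def hurwitzSeries (w z : ℂ) : ℂ := ∑' n : ℕ, ((n : ℂ) + z) ^ (-w)

/-- The Hurwitz zeta function `ζ(w, z)` with a complex parameter `z`, as a meromorphic function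
of `w` on the whole plane. -/
def hurwitzZetaFunction (w z : ℂ) : ℂ :=
  meromorphicContinuation (fun w' => hurwitzSeries w' z) 1 w

/-- The logarithm `∂ζ(w, z)/∂w |_{w = 1 - k}` of the Milnor gamma function of depth `k`. -/
def logMilnorGamma (k : ℕ) (z : ℂ) : ℂ :=
  deriv (fun w => hurwitzZetaFunction w z) (1 - (k : ℂ))

/-- The Milnor gamma function of depth `k`. -/
def milnorGamma (k : ℕ) (z : ℂ) : ℂ := Complex.exp (logMilnorGamma k z)

/-- The power `𝔊_k(z) ^ a`, formed with the logarithm `∂ζ(w, z)/∂w |_{w = 1 - k}`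
of `𝔊_k(z)`. -/
def milnorGammaPow (k : ℕ) (z a : ℂ) : ℂ := expPow (logMilnorGamma k z) a

/-- For integer exponents the power is the usual one. -/
theorem milnorGammaPow_intCast (k : ℕ) (z : ℂ) (n : ℤ) :
    milnorGammaPow k z (n : ℂ) = milnorGamma k z ^ n := by
  simp [milnorGammaPow, expPow, milnorGamma, Complex.exp_int_mul]

end

open Complex Set Filter Topology MeasureTheory

/-! Write t = s - 1/2 and tanh(πx) = 1 - 2/(e^{2πx}+1). In J_{2ℓ+1} the constant 1 gives an
elementary integral, continued as a finite sum with explicit poles, and the Fermi weight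
1/(e^{2πx}+1) gives an entire function of w. The binomial weights in φ_r resum the powers x^{2ℓ} to
(x²+t²)^{r-1}, so `sum_deriv_momentFunction` gives log φ_r as t^{2r}(1/r² - (2/r) log t) minus 4∫
log(x²+t²)(x²+t²)^{r-1} x/(e^{2πx}+1) dx.

The same weight occurs in Hermite's formula centred at 1/2, ζ(w,t+1/2) = t^{1-w}/(w-1) +
i∫((t-ix)^{-w} - (t+ix)^{-w})/(e^{2πx}+1) dx (`hurwitzSeries_eq_hermiteFormula`), because
e^{-u/2}/(1-e^{-u}) is 1/u minus twice the sine transform of the weight. Its derivative at w = 1-k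
(`logMilnorGamma_eq`) is an elementary term plus an integral of u^{k-1} log u at u = t±ix.

The exponents E_k satisfy Σ E_k u^{k-1} = 4(u(2t-u))^{r-1}(u-t) (`sum_milnorExponent_mul_pow`). At u
= t±ix this equals ±4ix(x²+t²)^{r-1}, so Σ E_k log 𝔊_k contains the same integral as log φ_r. The
elementary terms differ by (2r)!!/(r²(2r-1)!!) t^{2r}, which comes from ∫_0^1 x^{r-1}(2-x)^r dx
(`sum_choose_mul_two_pow_div`). Beyond the half-plane the identity theorem applies. -/

/-! ### Uniqueness of meromorphic continuation. -/

/-- Two meromorphic functions on the plane that agree on a right half plane agree near every point,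
except possibly at the point itself. -/
theorem MeromorphicOn.eventuallyEq_nhdsNE_of_eq_halfPlane {F G : ℂ → ℂ}
    (hF : MeromorphicOn F univ) (hG : MeromorphicOn G univ) {σ : ℝ}
    (h : ∀ w : ℂ, σ < w.re → F w = G w) (z : ℂ) : F =ᶠ[𝓝[≠] z] G := by
  have hz : ∀ u : ℂ, meromorphicOrderAt (F - G) u = ⊤ := by
    by_contra hne
    push Not at hne
    have hm : MeromorphicOn (F - G) univ := hF.sub hG
    -- On a connected set the order of F - G is infinite everywhere or nowhere; at σ + 1 it is
    -- infinite.
    have hall := (hm.exists_meromorphicOrderAt_ne_top_iff_forall_mem isConnected_univ).1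
      (by obtain ⟨u, hu⟩ := hne; exact ⟨u, mem_univ _, hu⟩)
    refine hall ((σ + 1 : ℝ) : ℂ) (mem_univ _) (meromorphicOrderAt_eq_top_iff.2 ?_)
    refine Filter.Eventually.filter_mono nhdsWithin_le_nhds ?_
    filter_upwards [(isOpen_lt continuous_const continuous_re).mem_nhds
      (show σ < ((σ + 1 : ℝ) : ℂ).re by simp)] with w hw
    simp [h w hw]
  filter_upwards [meromorphicOrderAt_eq_top_iff.1 (hz z)] with w hw
  exact sub_eq_zero.1 hw

/-- Passing to normal form changes values only at isolated points, and two functions in normal form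
that agree on a punctured neighbourhood agree at its centre. -/
theorem toMeromorphicNFOn_eq_of_analyticAt {F : ℂ → ℂ} (hF : MeromorphicOn F univ) {z : ℂ}
    (hz : AnalyticAt ℂ F z) : toMeromorphicNFOn F univ =ᶠ[𝓝 z] F := by
  refine ((meromorphicNFOn_toMeromorphicNFOn F univ
    (mem_univ z)).eventuallyEq_nhdsNE_iff_eventuallyEq_nhds hz.meromorphicNFAt).1 ?_
  exact hF.toMeromorphicNFOn_eq_self_on_nhdsNE (mem_univ z)

/-- A meromorphic function `F` which on a half plane is analytic and equal to `f` gives the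
meromorphic continuation of `f`. -/
theorem isMeromorphicContinuation_meromorphicContinuation {f F : ℂ → ℂ} {σ : ℝ}
    (hF : MeromorphicOn F univ)
    (h : ∀ w : ℂ, σ < w.re → AnalyticAt ℂ F w ∧ F w = f w) :
    IsMeromorphicContinuation f σ (meromorphicContinuation f σ) := by
  have hex : ∃ G : ℂ → ℂ, IsMeromorphicContinuation f σ G :=
    ⟨toMeromorphicNFOn F univ, meromorphicNFOn_toMeromorphicNFOn F univ, fun w hw => by
      rw [(toMeromorphicNFOn_eq_of_analyticAt hF (h w hw).1).eq_of_nhds, (h w hw).2]⟩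
  rw [meromorphicContinuation, dif_pos hex]
  exact hex.choose_spec

/-- Replaces the continuation, obtained by choice, by an explicit formula near z, so that its
derivative can be computed. -/
theorem meromorphicContinuation_eventuallyEq {f F : ℂ → ℂ} {σ : ℝ}
    (hF : MeromorphicOn F univ)
    (h : ∀ w : ℂ, σ < w.re → AnalyticAt ℂ F w ∧ F w = f w) {z : ℂ} (hz : AnalyticAt ℂ F z) :
    meromorphicContinuation f σ =ᶠ[𝓝 z] F := by
  obtain ⟨h1, h2⟩ := isMeromorphicContinuation_meromorphicContinuation hF h
  refine ((h1 (mem_univ z)).eventuallyEq_nhdsNE_iff_eventuallyEq_nhds hz.meromorphicNFAt).1 ?_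
  exact MeromorphicOn.eventuallyEq_nhdsNE_of_eq_halfPlane h1.meromorphicOn hF
    (fun w hw => (h2 w hw).trans (h w hw).2.symm) z

/-! ### Parameter integrals against an exponentially decaying weight. -/

/-- Differentiation under the integral sign for `∫ exp (-w λ(x)) h(x) dx`, where `λ` grows
sublinearly and `h` decays exponentially. -/
theorem hasDerivAt_integral_exp_neg_mul {lam h : ℝ → ℂ} (hlam : ContinuousOn lam (Ioi 0))
    (hh : ContinuousOn h (Ioi 0))
    (hg : ∀ R : ℝ, 0 < R → ∃ C : ℝ, ∀ x : ℝ, 0 < x → R * ‖lam x‖ ≤ C + x)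
    (hi : IntegrableOn (fun x => Real.exp x * ‖h x‖) (Ioi 0)) (w : ℂ) :
    IntegrableOn (fun x => exp (-w * lam x) * h x) (Ioi 0) ∧
    IntegrableOn (fun x => -lam x * exp (-w * lam x) * h x) (Ioi 0) ∧
    HasDerivAt (fun v => ∫ x in Ioi (0 : ℝ), exp (-v * lam x) * h x)
      (∫ x in Ioi (0 : ℝ), -lam x * exp (-w * lam x) * h x) w := by
  -- On the unit ball about w one has ‖v‖ ≤ ‖w‖ + 1; the further 1 pays for the factor λ produced by
  -- differentiation, through ‖λ‖ ≤ e^‖λ‖.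
  obtain ⟨C, hC⟩ := hg (‖w‖ + 2) (by positivity)
  have hb1 : ∀ x : ℝ, 0 < x → ∀ v ∈ Metric.ball w 1,
      ‖exp (-v * lam x)‖ * Real.exp ‖lam x‖ ≤ Real.exp C * Real.exp x := by
    intro x hx v hv
    rw [norm_exp, ← Real.exp_add, ← Real.exp_add, Real.exp_le_exp]
    have h1 : (-v * lam x).re ≤ ‖v‖ * ‖lam x‖ := by
      simpa using re_le_norm (-v * lam x)
    have h2 : ‖v‖ ≤ ‖w‖ + 1 := by
      have : ‖v - w‖ < 1 := by simpa [dist_eq_norm] using hv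
      calc ‖v‖ = ‖w + (v - w)‖ := by ring_nf
        _ ≤ ‖w‖ + ‖v - w‖ := norm_add_le _ _
        _ ≤ _ := by linarith
    nlinarith [hC x hx, norm_nonneg (lam x)]
  have hlb : ∀ x : ℝ, ‖lam x‖ ≤ Real.exp ‖lam x‖ := fun x => by
    linarith [Real.add_one_le_exp ‖lam x‖]
  have hint : IntegrableOn (fun x => Real.exp C * (Real.exp x * ‖h x‖)) (Ioi 0) := hi.const_mul _
  have hmeas : ∀ v : ℂ, AEStronglyMeasurable (fun x => exp (-v * lam x) * h x)
      (volume.restrict (Ioi 0)) := fun v =>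
    ContinuousOn.aestronglyMeasurable (by fun_prop) measurableSet_Ioi
  have hint0 : IntegrableOn (fun x => exp (-w * lam x) * h x) (Ioi 0) := by
    refine Integrable.mono' hint (hmeas w) ?_
    refine (ae_restrict_iff' measurableSet_Ioi).2 (ae_of_all _ fun x hx => ?_)
    rw [norm_mul, ← mul_assoc]
    refine mul_le_mul_of_nonneg_right (le_trans ?_ (hb1 x hx w (by simp))) (norm_nonneg _)
    exact le_mul_of_one_le_right (norm_nonneg _) (Real.one_le_exp (norm_nonneg _))
  refine ⟨hint0, ?_⟩
  refine hasDerivAt_integral_of_dominated_loc_of_deriv_le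
    (F := fun v x => exp (-v * lam x) * h x) (F' := fun v x => -lam x * exp (-v * lam x) * h x)
    (bound := fun x => Real.exp C * (Real.exp x * ‖h x‖))
    (Metric.ball_mem_nhds w one_pos) (Eventually.of_forall hmeas) hint0 ?_ ?_ hint ?_
  · exact ContinuousOn.aestronglyMeasurable (by fun_prop) measurableSet_Ioi
  · refine (ae_restrict_iff' measurableSet_Ioi).2 (ae_of_all _ fun x hx v hv => ?_)
    rw [norm_mul, norm_mul, norm_neg, ← mul_assoc]
    refine mul_le_mul_of_nonneg_right (le_trans ?_ (hb1 x hx v hv)) (norm_nonneg _)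
    rw [mul_comm]
    exact mul_le_mul_of_nonneg_left (hlb x) (norm_nonneg _)
  · refine ae_of_all _ fun x v _ => ?_
    have h1 : HasDerivAt (fun v : ℂ => -v * lam x) (-lam x) v := by
      simpa using (hasDerivAt_id v).neg.mul_const (lam x)
    exact (h1.cexp.mul_const (h x)).congr_deriv (by ring)

theorem analyticAt_integral_exp_neg_mul {lam h : ℝ → ℂ} (hlam : ContinuousOn lam (Ioi 0))
    (hh : ContinuousOn h (Ioi 0))
    (hg : ∀ R : ℝ, 0 < R → ∃ C : ℝ, ∀ x : ℝ, 0 < x → R * ‖lam x‖ ≤ C + x)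
    (hi : IntegrableOn (fun x => Real.exp x * ‖h x‖) (Ioi 0)) (w : ℂ) :
    AnalyticAt ℂ (fun v => ∫ x in Ioi (0 : ℝ), exp (-v * lam x) * h x) w := by
  have : Differentiable ℂ (fun v => ∫ x in Ioi (0 : ℝ), exp (-v * lam x) * h x) := fun v =>
    (hasDerivAt_integral_exp_neg_mul hlam hh hg hi v).2.2.differentiableAt
  exact this.analyticAt w

theorem continuous_inv_exp_two_pi_add_one :
    Continuous fun x : ℝ => (Real.exp (2 * Real.pi * x) + 1)⁻¹ :=
  Continuous.inv₀ (by fun_prop) fun x => by positivity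

/-- The weight `x ^ m / (e ^ (2 π x) + 1)`. -/
noncomputable def fermiWeight (m : ℕ) (x : ℝ) : ℂ :=
  (x : ℂ) ^ m * (((Real.exp (2 * Real.pi * x) + 1)⁻¹ : ℝ) : ℂ)

theorem continuous_fermiWeight (m : ℕ) : Continuous (fermiWeight m) :=
  (continuous_ofReal.pow m).mul
    (continuous_ofReal.comp continuous_inv_exp_two_pi_add_one)

theorem integrableOn_pow_mul_exp_neg (m : ℕ) :
    IntegrableOn (fun x : ℝ => x ^ m * Real.exp (-x)) (Ioi 0) := by
  have := Real.GammaIntegral_convergent (s := m + 1) (by positivity)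
  refine this.congr_fun (fun x hx => ?_) measurableSet_Ioi
  simp [mul_comm]

theorem inv_exp_two_pi_add_one_le {x : ℝ} (hx : 0 < x) :
    (Real.exp (2 * Real.pi * x) + 1)⁻¹ ≤ Real.exp (-(2 * x)) := by
  rw [Real.exp_neg]
  refine inv_anti₀ (Real.exp_pos _) ?_
  have : Real.exp (2 * x) ≤ Real.exp (2 * Real.pi * x) :=
    Real.exp_le_exp.2 (by nlinarith [Real.pi_gt_three])
  linarith

/-- The weight decays at least like x^m e^{-2x}, so e^{-x} is left after multiplication by e^x. -/
theorem integrableOn_exp_mul_fermiWeight (m : ℕ) :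
    IntegrableOn (fun x => Real.exp x * ‖fermiWeight m x‖) (Ioi 0) := by
  refine Integrable.mono' (integrableOn_pow_mul_exp_neg m) ?_ ?_
  · exact (Real.continuous_exp.mul (continuous_fermiWeight m).norm).aestronglyMeasurable
  · refine (ae_restrict_iff' measurableSet_Ioi).2 (ae_of_all _ fun x (hx : 0 < x) => ?_)
    have h1 : ‖fermiWeight m x‖ = x ^ m * (Real.exp (2 * Real.pi * x) + 1)⁻¹ := by
      rw [fermiWeight, norm_mul, norm_pow, norm_real, norm_real, Real.norm_of_nonneg hx.le,
        Real.norm_of_nonneg (by positivity)]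
    rw [h1, Real.norm_of_nonneg (by positivity)]
    calc Real.exp x * (x ^ m * (Real.exp (2 * Real.pi * x) + 1)⁻¹)
        ≤ Real.exp x * (x ^ m * Real.exp (-(2 * x))) := by
          gcongr; exact inv_exp_two_pi_add_one_le hx
      _ = x ^ m * (Real.exp x * Real.exp (-(2 * x))) := by ring
      _ = _ := by rw [← Real.exp_add]; ring_nf

/-! ### Branches and growth of log(t ± ix) and log(x² + t²). -/

section Logarithms

variable {t : ℂ} (ht : 0 < t.re)
include ht

theorem mem_slitPlane_add_mul_I (x : ℝ) : t + x * I ∈ slitPlane := by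
  left; simpa using ht

theorem mem_slitPlane_sub_mul_I (x : ℝ) : t - x * I ∈ slitPlane := by
  left; simpa using ht

theorem continuous_log_add_mul_I : Continuous fun x : ℝ => log (t + x * I) :=
  Continuous.clog (by fun_prop) (mem_slitPlane_add_mul_I ht)

theorem continuous_log_sub_mul_I : Continuous fun x : ℝ => log (t - x * I) :=
  Continuous.clog (by fun_prop) (mem_slitPlane_sub_mul_I ht)

/-- Both factors t ± ix lie in the right half-plane, so their arguments add up without leaving (-π,
π). -/
theorem log_sq_add_sq (x : ℝ) :
    log ((x : ℂ) ^ 2 + t ^ 2) = log (t + x * I) + log (t - x * I) := by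
  have h1 : (x : ℂ) ^ 2 + t ^ 2 = (t + x * I) * (t - x * I) := by
    linear_combination (x : ℂ) ^ 2 * I_sq
  have ha := abs_lt.1 (abs_arg_lt_pi_div_two_iff.2
    (Or.inl (show 0 < (t + x * I).re by simpa using ht)))
  have hb := abs_lt.1 (abs_arg_lt_pi_div_two_iff.2
    (Or.inl (show 0 < (t - x * I).re by simpa using ht)))
  rw [h1, log_mul (slitPlane_ne_zero (mem_slitPlane_add_mul_I ht x))
    (slitPlane_ne_zero (mem_slitPlane_sub_mul_I ht x)) ⟨by linarith, by linarith⟩]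

theorem sq_add_sq_mem_slitPlane (x : ℝ) : (x : ℂ) ^ 2 + t ^ 2 ∈ slitPlane := by
  have h1 : (x : ℂ) ^ 2 + t ^ 2 = (t + x * I) * (t - x * I) := by
    linear_combination (x : ℂ) ^ 2 * I_sq
  have hne : (x : ℂ) ^ 2 + t ^ 2 ≠ 0 := by
    rw [h1]
    exact mul_ne_zero (slitPlane_ne_zero (mem_slitPlane_add_mul_I ht x))
      (slitPlane_ne_zero (mem_slitPlane_sub_mul_I ht x))
  rw [mem_slitPlane_iff_arg]
  refine ⟨?_, hne⟩
  have ha := abs_lt.1 (abs_arg_lt_pi_div_two_iff.2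
    (Or.inl (show 0 < (t + x * I).re by simpa using ht)))
  have hb := abs_lt.1 (abs_arg_lt_pi_div_two_iff.2
    (Or.inl (show 0 < (t - x * I).re by simpa using ht)))
  have := congrArg im (log_sq_add_sq ht x)
  simp only [add_im, log_im] at this
  rw [this]
  exact ne_of_lt (by linarith [ha.2, hb.2])

omit ht in
theorem log_growth {z : ℝ → ℂ} {a b : ℝ} (ha : 0 < a) (hb : 0 < b)
    (h1 : ∀ x, 0 < x → a ≤ ‖z x‖) (h2 : ∀ x, 0 < x → ‖z x‖ ≤ b + x) (R : ℝ) (hR : 0 < R) :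
    ∃ C : ℝ, ∀ x : ℝ, 0 < x → R * ‖log (z x)‖ ≤ C + x := by
  refine ⟨b + R * |Real.log R| + R * |Real.log a| + R * Real.pi, fun x hx => ?_⟩
  have hz : 0 < ‖z x‖ := ha.trans_le (h1 x hx)
  have h3 : ‖log (z x)‖ ≤ |Real.log ‖z x‖| + Real.pi := by
    refine (norm_le_abs_re_add_abs_im _).trans ?_
    rw [log_re, log_im]
    linarith [abs_arg_le_pi (z x)]
  have h4 : -|Real.log a| ≤ Real.log ‖z x‖ :=
    (neg_abs_le _).trans (Real.log_le_log ha (h1 x hx))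
  have h5 : R * Real.log ‖z x‖ ≤ b + x + R * |Real.log R| := by
    -- The inequality log y ≤ y - 1 at y = ‖z‖/R makes the coefficient of ‖z‖, hence of x, exactly
    -- 1.
    have h6 := Real.log_le_sub_one_of_pos (div_pos hz hR)
    rw [Real.log_div hz.ne' hR.ne'] at h6
    have h7 : R * Real.log ‖z x‖ ≤ R * (‖z x‖ / R - 1 + Real.log R) :=
      mul_le_mul_of_nonneg_left (by linarith) hR.le
    have h8 : R * (‖z x‖ / R - 1 + Real.log R) = ‖z x‖ - R + R * Real.log R := by
      field_simp
    nlinarith [h2 x hx, le_abs_self (Real.log R)]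
  have h9 : R * |Real.log ‖z x‖| ≤ b + x + R * |Real.log R| + R * |Real.log a| := by
    have e1 : 0 ≤ R * |Real.log R| := by positivity
    have e2 : 0 ≤ R * |Real.log a| := by positivity
    rcases abs_cases (Real.log ‖z x‖) with ⟨h, _⟩ | ⟨h, _⟩
    · rw [h]; linarith
    · rw [h]; nlinarith
  nlinarith

theorem log_add_mul_I_growth (R : ℝ) (hR : 0 < R) :
    ∃ C : ℝ, ∀ x : ℝ, 0 < x → R * ‖log (t + x * I)‖ ≤ C + x := by
  refine log_growth (b := ‖t‖) ht (ht.trans_le (re_le_norm t)) (fun x _ => ?_) (fun x hx => ?_) R hR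
  · simpa using re_le_norm (t + x * I)
  · simpa [abs_of_pos hx] using norm_add_le t (x * I)

theorem log_sub_mul_I_growth (R : ℝ) (hR : 0 < R) :
    ∃ C : ℝ, ∀ x : ℝ, 0 < x → R * ‖log (t - x * I)‖ ≤ C + x := by
  refine log_growth (b := ‖t‖) ht (ht.trans_le (re_le_norm t)) (fun x _ => ?_) (fun x hx => ?_) R hR
  · simpa using re_le_norm (t - x * I)
  · simpa [abs_of_pos hx] using norm_sub_le t (x * I)

theorem continuous_log_sq_add_sq : Continuous fun x : ℝ => log ((x : ℂ) ^ 2 + t ^ 2) :=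
  Continuous.clog (by fun_prop) (sq_add_sq_mem_slitPlane ht)

theorem log_sq_add_sq_growth (R : ℝ) (hR : 0 < R) :
    ∃ C : ℝ, ∀ x : ℝ, 0 < x → R * ‖log ((x : ℂ) ^ 2 + t ^ 2)‖ ≤ C + x := by
  -- Each of the two logarithms may use only half of the allowance x, hence 2R.
  obtain ⟨C₁, h₁⟩ := log_add_mul_I_growth ht (2 * R) (by positivity)
  obtain ⟨C₂, h₂⟩ := log_sub_mul_I_growth ht (2 * R) (by positivity)
  refine ⟨(C₁ + C₂) / 2, fun x hx => ?_⟩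
  rw [log_sq_add_sq ht]
  nlinarith [h₁ x hx, h₂ x hx, norm_add_le (log (t + x * I)) (log (t - x * I))]

end Logarithms

/-! ### The moment functions and the logarithm of the gamma factor. -/

section MomentIntegral

variable {t : ℂ} (ht : 0 < t.re)
include ht

theorem norm_exp_neg_mul_log_sq_add_sq_le {w : ℂ} (hw : 0 ≤ w.re) :
    ∃ K : ℝ, ∀ x : ℝ, 0 ≤ x →
      ‖exp (-w * log ((x : ℂ) ^ 2 + t ^ 2))‖ ≤ K * (x + 1) ^ (-(2 * w.re)) := by
  set a := t.re with ha
  set b := |t.im| with hb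
  have hb0 : 0 ≤ b := abs_nonneg _
  -- This c gives c(x+1) ≤ ‖t ± ix‖: for x ≤ a+b use ‖z‖ ≥ Re z = a, otherwise ‖z‖ ≥ x - b. The two
  -- bounds meet at x = a+b, where both equal a.
  set c := a / (1 + a + b) with hc
  have hc0 : 0 < c := by positivity
  have hc1 : c * (1 + a + b) = a := by rw [hc]; field_simp
  have key : ∀ (x y : ℝ) (z : ℂ), 0 ≤ x → z.re = a → z.im = t.im + y → |y| = x →
      c * (x + 1) ≤ ‖z‖ := by
    intro x y z hx hre him hy
    have h1 : a ≤ ‖z‖ := hre ▸ re_le_norm z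
    have h2 : x - b ≤ ‖z‖ := by
      have : |y| ≤ |z.im| + |t.im| := by
        have := abs_sub z.im t.im
        rwa [show z.im - t.im = y by rw [him]; ring] at this
      linarith [abs_im_le_norm z]
    rcases le_total x (a + b) with h | h
    · nlinarith
    · have hcle : c ≤ 1 := by
        rw [hc, div_le_one (by positivity)]; linarith
      nlinarith
  refine ⟨Real.exp (Real.pi * |w.im|) * c ^ (-(2 * w.re)), fun x hx => ?_⟩
  have h1 := key x x (t + x * I) hx (by simp [ha]) (by simp) (abs_of_nonneg hx)
  have h2 := key x (-x) (t - x * I) hx (by simp [ha]) (by simp; ring)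
    (by rw [abs_neg, abs_of_nonneg hx])
  have hpos : 0 < c * (x + 1) := by positivity
  have h3 : 2 * Real.log (c * (x + 1)) ≤ (log ((x : ℂ) ^ 2 + t ^ 2)).re := by
    rw [log_sq_add_sq ht, add_re, log_re, log_re]
    linarith [Real.log_le_log hpos h1, Real.log_le_log hpos h2]
  have h4 : w.im * (log ((x : ℂ) ^ 2 + t ^ 2)).im ≤ Real.pi * |w.im| := by
    rw [log_im]
    calc w.im * arg ((x : ℂ) ^ 2 + t ^ 2) ≤ |w.im * arg ((x : ℂ) ^ 2 + t ^ 2)| := le_abs_self _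
      _ = |w.im| * |arg ((x : ℂ) ^ 2 + t ^ 2)| := abs_mul _ _
      _ ≤ |w.im| * Real.pi := by gcongr; exact abs_arg_le_pi _
      _ = _ := mul_comm _ _
  rw [mul_assoc, ← Real.mul_rpow hc0.le (by positivity), Real.rpow_def_of_pos hpos, norm_exp,
    ← Real.exp_add, Real.exp_le_exp]
  simp only [mul_re, neg_re, neg_im]
  nlinarith [mul_le_mul_of_nonneg_left h3 hw]

theorem integrableOn_exp_neg_mul_log_mul_pow (m : ℕ) {w : ℂ} (hw : ((m : ℝ) + 1) / 2 < w.re) :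
    IntegrableOn (fun x : ℝ => exp (-w * log ((x : ℂ) ^ 2 + t ^ 2)) * (x : ℂ) ^ m) (Ioi 0) := by
  have hw0 : 0 ≤ w.re := le_trans (by positivity) hw.le
  obtain ⟨K, hK⟩ := norm_exp_neg_mul_log_sq_add_sq_le ht hw0
  have hi : IntegrableOn (fun x : ℝ => K * (x + 1) ^ ((m : ℝ) - 2 * w.re)) (Ioi 0) :=
    (integrableOn_add_rpow_Ioi_of_lt (by linarith) (by norm_num)).const_mul K
  have hcont := continuous_log_sq_add_sq ht
  refine Integrable.mono' hi (Continuous.aestronglyMeasurable (by fun_prop)) ?_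
  refine (ae_restrict_iff' measurableSet_Ioi).2 (ae_of_all _ fun x (hx : 0 < x) => ?_)
  have hK0 : 0 ≤ K * (x + 1) ^ (-(2 * w.re)) := (norm_nonneg _).trans (hK x hx.le)
  rw [norm_mul, norm_pow, norm_real, Real.norm_of_nonneg hx.le]
  calc _ ≤ K * (x + 1) ^ (-(2 * w.re)) * (x + 1) ^ m := by
        gcongr
        · exact hK x hx.le
        · linarith
    _ = K * ((x + 1) ^ (-(2 * w.re)) * (x + 1) ^ (m : ℝ)) := by rw [Real.rpow_natCast]; ring
    _ = _ := by
      rw [← Real.rpow_add (by positivity)]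
      ring_nf

/-- The antiderivative is (x²+t²)^{1-v}/(2(1-v)); it is legitimate for complex t because x²+t²
avoids the branch cut, and it vanishes at infinity. -/
theorem integral_exp_neg_mul_log_mul_self {v : ℂ} (hv : 1 < v.re) :
    ∫ x in Ioi (0 : ℝ), exp (-v * log ((x : ℂ) ^ 2 + t ^ 2)) * (x : ℂ) =
      exp ((1 - v) * (2 * log t)) / (2 * (v - 1)) := by
  have hv1 : v - 1 ≠ 0 := fun h => by
    have := congrArg re h
    simp at this
    linarith
  have hint := integrableOn_exp_neg_mul_log_mul_pow ht 1 (w := v) (by norm_num; exact hv)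
  simp only [pow_one] at hint
  have hd : ∀ x ∈ Ici (0 : ℝ), HasDerivAt
      (fun x : ℝ => exp (-(v - 1) * log ((x : ℂ) ^ 2 + t ^ 2)) / (-2 * (v - 1)))
      (exp (-v * log ((x : ℂ) ^ 2 + t ^ 2)) * (x : ℂ)) x := by
    intro x _
    have hs := sq_add_sq_mem_slitPlane ht x
    have h1 : HasDerivAt (fun x : ℝ => (x : ℂ) ^ 2 + t ^ 2) (2 * x) x := by
      simpa using ((hasDerivAt_id x).ofReal_comp.pow 2).add_const (t ^ 2)
    have h2 := (((h1.clog_real hs).const_mul (-(v - 1))).cexp).div_const (-2 * (v - 1))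
    refine h2.congr_deriv ?_
    rw [show -(v - 1) * log ((x : ℂ) ^ 2 + t ^ 2) =
      log ((x : ℂ) ^ 2 + t ^ 2) + -v * log ((x : ℂ) ^ 2 + t ^ 2) by ring, exp_add,
      exp_log (slitPlane_ne_zero hs)]
    have := slitPlane_ne_zero hs
    field_simp
  have htend : Tendsto
      (fun x : ℝ => exp (-(v - 1) * log ((x : ℂ) ^ 2 + t ^ 2)) / (-2 * (v - 1))) atTop (𝓝 0) := by
    obtain ⟨K, hK⟩ := norm_exp_neg_mul_log_sq_add_sq_le ht (w := v - 1) (by simp; linarith)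
    have h0 : Tendsto (fun x : ℝ => K * (x + 1) ^ (-(2 * (v - 1).re))) atTop (𝓝 0) := by
      have := (tendsto_rpow_neg_atTop (y := 2 * (v - 1).re) (by simp; linarith)).comp
        (tendsto_atTop_add_const_right _ (1 : ℝ) tendsto_id)
      simpa using this.const_mul K
    have h1 : Tendsto (fun x : ℝ => exp (-(v - 1) * log ((x : ℂ) ^ 2 + t ^ 2))) atTop (𝓝 0) := by
      refine squeeze_zero_norm' ?_ h0
      filter_upwards [eventually_ge_atTop 0] with x hx using hK x hx
    simpa using h1.div_const (-2 * (v - 1))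
  rw [integral_Ioi_of_hasDerivAt_of_tendsto' hd hint htend]
  have h0 : log (((0 : ℝ) : ℂ) ^ 2 + t ^ 2) = 2 * log t := by
    rw [log_sq_add_sq ht]; simp; ring
  rw [h0, show -(v - 1) = 1 - v by ring]
  field_simp
  ring

omit ht in
/-- The continuation to the plane of `∫ (x² + t²)^(-w) x^(2ℓ+1) dx`. -/
noncomputable def powerPart (ℓ : ℕ) (t w : ℂ) : ℂ :=
  ∑ j ∈ Finset.range (ℓ + 1), (ℓ.choose j : ℂ) * (-t ^ 2) ^ (ℓ - j) *
    (exp ((1 + j - w) * (2 * log t)) / (2 * (w - j - 1)))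

theorem exp_neg_sub_mul_log_sq_add_sq (w : ℂ) (j : ℕ) (x : ℝ) :
    exp (-(w - j) * log ((x : ℂ) ^ 2 + t ^ 2)) =
      ((x : ℂ) ^ 2 + t ^ 2) ^ j * exp (-w * log ((x : ℂ) ^ 2 + t ^ 2)) := by
  rw [show -(w - j) * log ((x : ℂ) ^ 2 + t ^ 2) =
      j * log ((x : ℂ) ^ 2 + t ^ 2) + -w * log ((x : ℂ) ^ 2 + t ^ 2) by ring, exp_add,
      exp_nat_mul, exp_log (slitPlane_ne_zero (sq_add_sq_mem_slitPlane ht x))]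

theorem integral_exp_neg_mul_log_mul_pow (ℓ : ℕ) {w : ℂ} (hw : (ℓ : ℝ) + 1 < w.re) :
    ∫ x in Ioi (0 : ℝ), exp (-w * log ((x : ℂ) ^ 2 + t ^ 2)) * (x : ℂ) ^ (2 * ℓ + 1) =
      powerPart ℓ t w := by
  have h1 : ∀ x : ℝ, exp (-w * log ((x : ℂ) ^ 2 + t ^ 2)) * (x : ℂ) ^ (2 * ℓ + 1) =
      ∑ j ∈ Finset.range (ℓ + 1), (ℓ.choose j : ℂ) * (-t ^ 2) ^ (ℓ - j) *
        (exp (-(w - j) * log ((x : ℂ) ^ 2 + t ^ 2)) * (x : ℂ)) := by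
    intro x
    -- Expanding x² = (x²+t²) - t² turns each term into the case of a single factor x, with w
    -- shifted to w - j.
    have e : ((x : ℂ) ^ 2) ^ ℓ = (((x : ℂ) ^ 2 + t ^ 2) + -t ^ 2) ^ ℓ := by ring_nf
    rw [pow_succ (x : ℂ) (2 * ℓ), pow_mul (x : ℂ) 2 ℓ, e, add_pow, Finset.sum_mul, Finset.mul_sum]
    refine Finset.sum_congr rfl fun j _ => ?_
    rw [exp_neg_sub_mul_log_sq_add_sq ht]
    ring
  have hre : ∀ j ∈ Finset.range (ℓ + 1), 1 < (w - j).re := by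
    intro j hj
    have : (j : ℝ) ≤ ℓ := by exact_mod_cast Nat.lt_succ_iff.1 (Finset.mem_range.1 hj)
    simp; linarith
  simp_rw [h1]
  rw [integral_finsetSum]
  · refine Finset.sum_congr rfl fun j hj => ?_
    rw [integral_const_mul, integral_exp_neg_mul_log_mul_self ht (hre j hj)]
    ring_nf
  · intro j hj
    have := integrableOn_exp_neg_mul_log_mul_pow ht 1 (w := w - j)
      (by norm_num; simpa using hre j hj)
    simp only [pow_one] at this
    exact this.const_mul _

omit ht in
theorem meromorphicOn_powerPart (ℓ : ℕ) : MeromorphicOn (powerPart ℓ t) univ := by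
  intro w _
  unfold powerPart
  refine MeromorphicAt.fun_sum fun j _ => ?_
  refine (MeromorphicAt.const _ _).mul (MeromorphicAt.div ?_ ?_)
  · exact AnalyticAt.meromorphicAt (by fun_prop)
  · exact AnalyticAt.meromorphicAt (by fun_prop)

omit ht in
theorem analyticAt_powerPart (ℓ : ℕ) {w : ℂ} (hw : ∀ j ≤ ℓ, w ≠ (j : ℂ) + 1) :
    AnalyticAt ℂ (powerPart ℓ t) w := by
  unfold powerPart
  refine Finset.analyticAt_fun_sum _ fun j hj => ?_
  refine analyticAt_const.mul (AnalyticAt.div (by fun_prop) (by fun_prop) ?_)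
  refine mul_ne_zero two_ne_zero fun h => hw j (Nat.lt_succ_iff.1 (Finset.mem_range.1 hj)) ?_
  linear_combination h

/-- The combination of the functions `powerPart` that comes from the binomial expansion of
`(x² + t²)^(r-1)`. -/
theorem sum_powerPart_eventuallyEq (r : ℕ) (hr : 1 ≤ r) :
    (fun w => ∑ ℓ ∈ Finset.range r, 2 * ((r - 1).choose ℓ : ℂ) * t ^ (2 * (r - 1 - ℓ)) *
      powerPart ℓ t w) =ᶠ[𝓝 0] fun w => exp ((r - w) * (2 * log t)) / (w - r) := by
  have ha1 : AnalyticAt ℂ (fun w => ∑ ℓ ∈ Finset.range r, 2 * ((r - 1).choose ℓ : ℂ) *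
      t ^ (2 * (r - 1 - ℓ)) * powerPart ℓ t w) 0 := by
    refine Finset.analyticAt_fun_sum _ fun ℓ _ => analyticAt_const.mul (analyticAt_powerPart ℓ ?_)
    intro j _ h
    have : ((j + 1 : ℕ) : ℂ) = 0 := by push_cast; exact h.symm
    exact absurd (Nat.cast_eq_zero.1 this) (by omega)
  have ha2 : AnalyticAt ℂ (fun w : ℂ => exp ((r - w) * (2 * log t)) / (w - r)) 0 := by
    refine AnalyticAt.div (by fun_prop) (by fun_prop) ?_
    rw [zero_sub, neg_ne_zero]
    exact_mod_cast (by omega : r ≠ 0)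
  refine (ha1.meromorphicNFAt.eventuallyEq_nhdsNE_iff_eventuallyEq_nhds ha2.meromorphicNFAt).1 ?_
  -- For Re w > r all integrals converge, and the sum is 2∫(x²+t²)^{r-1-w} x dx. Uniqueness carries
  -- the closed form to w = 0, where no integral of this kind converges.
  refine MeromorphicOn.eventuallyEq_nhdsNE_of_eq_halfPlane (σ := r) ?_ ?_ ?_ 0
  · intro w _
    exact MeromorphicAt.fun_sum fun ℓ _ =>
      (MeromorphicAt.const _ _).mul (meromorphicOn_powerPart ℓ w (mem_univ w))
  · intro w _
    exact MeromorphicAt.div (AnalyticAt.meromorphicAt (by fun_prop))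
      (AnalyticAt.meromorphicAt (by fun_prop))
  · intro w hw
    have hre : ∀ ℓ ∈ Finset.range r, (ℓ : ℝ) + 1 < w.re := by
      intro ℓ hℓ
      have : (ℓ : ℝ) + 1 ≤ r := by exact_mod_cast Finset.mem_range.1 hℓ
      linarith
    have hcast : ((r - 1 : ℕ) : ℂ) = r - 1 := by rw [Nat.cast_sub hr]; simp
    have h1 : ∀ x : ℝ, ∑ ℓ ∈ Finset.range r, 2 * ((r - 1).choose ℓ : ℂ) * t ^ (2 * (r - 1 - ℓ)) *
        (exp (-w * log ((x : ℂ) ^ 2 + t ^ 2)) * (x : ℂ) ^ (2 * ℓ + 1)) =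
        2 * (exp (-(w - (r - 1 : ℕ)) * log ((x : ℂ) ^ 2 + t ^ 2)) * x) := by
      intro x
      rw [exp_neg_sub_mul_log_sq_add_sq ht, add_pow, Nat.sub_add_cancel hr]
      simp only [Finset.sum_mul, Finset.mul_sum]
      refine Finset.sum_congr rfl fun ℓ _ => ?_
      rw [pow_succ (x : ℂ) (2 * ℓ), pow_mul (x : ℂ) 2 ℓ, pow_mul t 2]
      ring
    rw [Finset.sum_congr rfl fun ℓ hℓ => by
      rw [← integral_exp_neg_mul_log_mul_pow ht ℓ (hre ℓ hℓ), ← integral_const_mul]]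
    rw [← integral_finsetSum]
    · simp_rw [h1]
      rw [integral_const_mul, integral_exp_neg_mul_log_mul_self ht, hcast]
      · rw [show (1 : ℂ) - (w - (r - 1)) = r - w by ring, show w - ((r : ℂ) - 1) - 1 = w - r by ring]
        rw [← div_div]
        ring
      · rw [hcast]; simp; linarith
    · intro ℓ hℓ
      refine Integrable.const_mul ?_ _
      refine integrableOn_exp_neg_mul_log_mul_pow ht (2 * ℓ + 1) ?_
      push_cast; linarith [hre ℓ hℓ]

omit ht in
/-- The entire part of the moment function. -/
noncomputable def fermiPart (ℓ : ℕ) (t w : ℂ) : ℂ :=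
  ∫ x in Ioi (0 : ℝ), exp (-w * log ((x : ℂ) ^ 2 + t ^ 2)) * fermiWeight (2 * ℓ + 1) x

omit ht in
-- Separates the part responsible for the divergence at infinity from an exponentially small one.
theorem tanh_pi_mul (x : ℝ) :
    Real.tanh (Real.pi * x) = 1 - 2 * (Real.exp (2 * Real.pi * x) + 1)⁻¹ := by
  have h1 : Real.exp (2 * Real.pi * x) = Real.exp (Real.pi * x) * Real.exp (Real.pi * x) := by
    rw [← Real.exp_add]; ring_nf
  rw [Real.tanh_eq, h1, Real.exp_neg]
  have := Real.exp_pos (Real.pi * x)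
  field_simp
  ring

theorem hasDerivAt_fermiPart (ℓ : ℕ) (w : ℂ) :
    IntegrableOn (fun x : ℝ => exp (-w * log ((x : ℂ) ^ 2 + t ^ 2)) * fermiWeight (2 * ℓ + 1) x)
      (Ioi 0) ∧
    IntegrableOn (fun x : ℝ => -log ((x : ℂ) ^ 2 + t ^ 2) *
      exp (-w * log ((x : ℂ) ^ 2 + t ^ 2)) * fermiWeight (2 * ℓ + 1) x) (Ioi 0) ∧
    HasDerivAt (fermiPart ℓ t) (∫ x in Ioi (0 : ℝ), -log ((x : ℂ) ^ 2 + t ^ 2) *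
      exp (-w * log ((x : ℂ) ^ 2 + t ^ 2)) * fermiWeight (2 * ℓ + 1) x) w :=
  hasDerivAt_integral_exp_neg_mul (continuous_log_sq_add_sq ht).continuousOn
    (continuous_fermiWeight _).continuousOn (log_sq_add_sq_growth ht)
    (integrableOn_exp_mul_fermiWeight _) w

theorem analyticAt_fermiPart (ℓ : ℕ) (w : ℂ) : AnalyticAt ℂ (fermiPart ℓ t) w :=
  analyticAt_integral_exp_neg_mul (continuous_log_sq_add_sq ht).continuousOn
    (continuous_fermiWeight _).continuousOn (log_sq_add_sq_growth ht)
    (integrableOn_exp_mul_fermiWeight _) w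

omit ht in
theorem momentIntegrand_eq (m : ℕ) (w : ℂ) :
    momentIntegrand m w t = fun x : ℝ => exp (-w * log ((x : ℂ) ^ 2 + t ^ 2)) * (x : ℂ) ^ m -
      2 * (exp (-w * log ((x : ℂ) ^ 2 + t ^ 2)) * fermiWeight m x) := by
  ext x
  rw [momentIntegrand, tanh_pi_mul, fermiWeight]
  push_cast
  ring

theorem integrableOn_momentIntegrand (ℓ : ℕ) {w : ℂ} (hw : (ℓ : ℝ) + 1 < w.re) :
    IntegrableOn (momentIntegrand (2 * ℓ + 1) w t) (Ioi 0) := by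
  rw [momentIntegrand_eq]
  refine Integrable.sub ?_ ((hasDerivAt_fermiPart ht ℓ w).1.const_mul 2)
  exact integrableOn_exp_neg_mul_log_mul_pow ht _ (by push_cast; linarith)

theorem momentIntegral_eq (ℓ : ℕ) {w : ℂ} (hw : (ℓ : ℝ) + 1 < w.re) :
    momentIntegral (2 * ℓ + 1) w t = powerPart ℓ t w - 2 * fermiPart ℓ t w := by
  rw [momentIntegral, momentIntegrand_eq, integral_sub, integral_const_mul,
    integral_exp_neg_mul_log_mul_pow ht ℓ hw, fermiPart]
  · exact integrableOn_exp_neg_mul_log_mul_pow ht _ (by push_cast; linarith)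
  · exact (hasDerivAt_fermiPart ht ℓ w).1.const_mul 2

theorem meromorphicOn_powerPart_sub_fermiPart (ℓ : ℕ) :
    MeromorphicOn (fun w => powerPart ℓ t w - 2 * fermiPart ℓ t w) univ := fun w _ =>
  (meromorphicOn_powerPart ℓ w (mem_univ w)).sub
    ((MeromorphicAt.const 2 w).mul (analyticAt_fermiPart ht ℓ w).meromorphicAt)

theorem powerPart_sub_fermiPart_halfPlane (ℓ : ℕ) (w : ℂ)
    (hw : (((2 * ℓ + 1 : ℕ) : ℝ) + 1) / 2 < w.re) :
    AnalyticAt ℂ (fun w => powerPart ℓ t w - 2 * fermiPart ℓ t w) w ∧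
      powerPart ℓ t w - 2 * fermiPart ℓ t w = momentIntegral (2 * ℓ + 1) w t := by
  have hw' : (ℓ : ℝ) + 1 < w.re := by push_cast at hw; linarith
  refine ⟨AnalyticAt.sub (analyticAt_powerPart ℓ ?_)
    (analyticAt_const.mul (analyticAt_fermiPart ht ℓ w)), (momentIntegral_eq ht ℓ hw').symm⟩
  rintro j hj rfl
  have : (j : ℝ) ≤ ℓ := by exact_mod_cast hj
  simp at hw'
  linarith

theorem isMeromorphicContinuation_momentFunction (ℓ : ℕ) :
    IsMeromorphicContinuation (fun w => momentIntegral (2 * ℓ + 1) w t)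
      ((((2 * ℓ + 1 : ℕ) : ℝ) + 1) / 2) (fun w => momentFunction (2 * ℓ + 1) w t) :=
  isMeromorphicContinuation_meromorphicContinuation (meromorphicOn_powerPart_sub_fermiPart ht ℓ)
    (powerPart_sub_fermiPart_halfPlane ht ℓ)

omit ht in
theorem analyticAt_powerPart_zero (ℓ : ℕ) : AnalyticAt ℂ (powerPart ℓ t) 0 := by
  refine analyticAt_powerPart ℓ fun j _ h => ?_
  have : ((j + 1 : ℕ) : ℂ) = 0 := by push_cast; exact h.symm
  exact absurd (Nat.cast_eq_zero.1 this) (by omega)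

theorem momentFunction_eventuallyEq (ℓ : ℕ) :
    (fun w => momentFunction (2 * ℓ + 1) w t) =ᶠ[𝓝 0]
      fun w => powerPart ℓ t w - 2 * fermiPart ℓ t w :=
  meromorphicContinuation_eventuallyEq (meromorphicOn_powerPart_sub_fermiPart ht ℓ)
    (powerPart_sub_fermiPart_halfPlane ht ℓ)
    ((analyticAt_powerPart_zero ℓ).sub (analyticAt_const.mul (analyticAt_fermiPart ht ℓ 0)))

theorem analyticAt_momentFunction (ℓ : ℕ) :
    AnalyticAt ℂ (fun w => momentFunction (2 * ℓ + 1) w t) 0 :=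
  ((analyticAt_powerPart_zero ℓ).sub
    (analyticAt_const.mul (analyticAt_fermiPart ht ℓ 0))).congr
    (momentFunction_eventuallyEq ht ℓ).symm

/-- The logarithm of the gamma factor. -/
theorem sum_deriv_momentFunction (r : ℕ) (hr : 1 ≤ r) :
    ∑ ℓ ∈ Finset.range r, 2 * ((r - 1).choose ℓ : ℂ) * t ^ (2 * (r - 1 - ℓ)) *
      (-deriv (fun w => momentFunction (2 * ℓ + 1) w t) 0) =
    t ^ (2 * r) * (1 / (r : ℂ) ^ 2 - 2 / r * log t) -
      4 * ∫ x in Ioi (0 : ℝ), log ((x : ℂ) ^ 2 + t ^ 2) * ((x : ℂ) ^ 2 + t ^ 2) ^ (r - 1) *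
        fermiWeight 1 x := by
  have hr0 : (r : ℂ) ≠ 0 := by exact_mod_cast (by omega : r ≠ 0)
  have hdm : ∀ ℓ, deriv (fun w => momentFunction (2 * ℓ + 1) w t) 0 =
      deriv (powerPart ℓ t) 0 + 2 * ∫ x in Ioi (0 : ℝ), log ((x : ℂ) ^ 2 + t ^ 2) *
        fermiWeight (2 * ℓ + 1) x := by
    intro ℓ
    rw [(momentFunction_eventuallyEq ht ℓ).deriv_eq]
    rw [((analyticAt_powerPart_zero ℓ).differentiableAt.hasDerivAt.fun_sub
      ((hasDerivAt_fermiPart ht ℓ 0).2.2.const_mul 2)).deriv]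
    simp only [neg_zero, zero_mul, exp_zero, mul_one, neg_mul, integral_neg]
    ring
  have hpow : ∑ ℓ ∈ Finset.range r, 2 * ((r - 1).choose ℓ : ℂ) * t ^ (2 * (r - 1 - ℓ)) *
      deriv (powerPart ℓ t) 0 = t ^ (2 * r) * (2 / r * log t - 1 / (r : ℂ) ^ 2) := by
    -- The derivatives of the individual `powerPart` terms are never computed; only their weighted
    -- sum is differentiated, in its closed form.
    have h1 : HasDerivAt (fun w => ∑ ℓ ∈ Finset.range r, 2 * ((r - 1).choose ℓ : ℂ) *
        t ^ (2 * (r - 1 - ℓ)) * powerPart ℓ t w)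
        (∑ ℓ ∈ Finset.range r, 2 * ((r - 1).choose ℓ : ℂ) * t ^ (2 * (r - 1 - ℓ)) *
          deriv (powerPart ℓ t) 0) 0 := by
      refine HasDerivAt.fun_sum fun ℓ _ => ?_
      exact (analyticAt_powerPart_zero ℓ).differentiableAt.hasDerivAt.const_mul _
    have h2 : HasDerivAt (fun w : ℂ => exp ((r - w) * (2 * log t)) / (w - r))
        (t ^ (2 * r) * (2 / r * log t - 1 / (r : ℂ) ^ 2)) 0 := by
      have e1 : HasDerivAt (fun w : ℂ => (r - w) * (2 * log t)) (-1 * (2 * log t)) 0 :=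
        (((hasDerivAt_id (0 : ℂ)).const_sub (r : ℂ))).mul_const _
      have e2 : HasDerivAt (fun w : ℂ => w - r) 1 0 := (hasDerivAt_id (0 : ℂ)).sub_const _
      refine (e1.cexp.div e2 (by simpa using hr0)).congr_deriv ?_
      have e3 : exp ((r - 0) * (2 * log t)) = t ^ (2 * r) := by
        rw [show ((r : ℂ) - 0) * (2 * log t) = ((2 * r : ℕ) : ℂ) * log t by push_cast; ring,
          exp_nat_mul, exp_log (by rintro rfl; simp at ht)]
      rw [e3]
      field_simp
      ring
    rw [← h1.deriv, (sum_powerPart_eventuallyEq ht r hr).deriv_eq, h2.deriv]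
  have hint : ∑ ℓ ∈ Finset.range r, 2 * ((r - 1).choose ℓ : ℂ) * t ^ (2 * (r - 1 - ℓ)) *
      (∫ x in Ioi (0 : ℝ), log ((x : ℂ) ^ 2 + t ^ 2) * fermiWeight (2 * ℓ + 1) x) =
      2 * ∫ x in Ioi (0 : ℝ), log ((x : ℂ) ^ 2 + t ^ 2) * ((x : ℂ) ^ 2 + t ^ 2) ^ (r - 1) *
        fermiWeight 1 x := by
    simp_rw [← integral_const_mul]
    rw [← integral_finsetSum]
    · refine integral_congr_ae (ae_of_all _ fun x => ?_)
      simp only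
      rw [add_pow, Nat.sub_add_cancel hr]
      simp only [Finset.sum_mul, Finset.mul_sum]
      refine Finset.sum_congr rfl fun ℓ _ => ?_
      rw [fermiWeight, fermiWeight, pow_succ (x : ℂ) (2 * ℓ), pow_mul (x : ℂ) 2 ℓ, pow_mul t 2]
      ring
    · intro ℓ _
      refine Integrable.const_mul ?_ _
      have := (hasDerivAt_fermiPart ht ℓ 0).2.1.neg
      refine this.congr (ae_of_all _ fun x => ?_)
      simp
  simp_rw [hdm]
  rw [Finset.sum_congr rfl (fun ℓ _ => show _ =
    -(2 * ((r - 1).choose ℓ : ℂ) * t ^ (2 * (r - 1 - ℓ)) * deriv (powerPart ℓ t) 0) -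
    2 * (2 * ((r - 1).choose ℓ : ℂ) * t ^ (2 * (r - 1 - ℓ)) *
      ∫ x in Ioi (0 : ℝ), log ((x : ℂ) ^ 2 + t ^ 2) * fermiWeight (2 * ℓ + 1) x) by ring),
    Finset.sum_sub_distrib, Finset.sum_neg_distrib, ← Finset.mul_sum, hpow, hint]
  ring

end MomentIntegral

/-! ### Euler's Gamma integral with complex scale. -/

section GammaIntegral

theorem integrableOn_rpow_mul_exp_neg_mul {a b : ℝ} (ha : -1 < a) (hb : 0 < b) :
    IntegrableOn (fun u : ℝ => u ^ a * Real.exp (-b * u)) (Ioi 0) := by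
  simpa using integrableOn_rpow_mul_exp_neg_mul_rpow ha one_pos hb

theorem norm_cpow_mul_exp_neg_mul {u : ℝ} (hu : 0 < u) (w z : ℂ) :
    ‖(u : ℂ) ^ w * exp (-z * u)‖ = u ^ w.re * Real.exp (-z.re * u) := by
  rw [norm_mul, norm_cpow_eq_rpow_re_of_pos hu, norm_exp]
  simp

theorem continuousOn_cpow_mul_exp_neg_mul (w z : ℂ) :
    ContinuousOn (fun u : ℝ => (u : ℂ) ^ w * exp (-z * u)) (Ioi 0) := by
  refine ContinuousOn.mul (fun u hu => ?_) (by fun_prop)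
  exact (continuousAt_ofReal_cpow_const u w (Or.inr (ne_of_gt hu))).continuousWithinAt

theorem integrableOn_cpow_mul_exp_neg_mul {w z : ℂ} (hw : -1 < w.re) (hz : 0 < z.re) :
    IntegrableOn (fun u : ℝ => (u : ℂ) ^ w * exp (-z * u)) (Ioi 0) := by
  refine Integrable.mono' (integrableOn_rpow_mul_exp_neg_mul hw hz)
    ((continuousOn_cpow_mul_exp_neg_mul w z).aestronglyMeasurable measurableSet_Ioi) ?_
  exact (ae_restrict_iff' measurableSet_Ioi).2
    (ae_of_all _ fun u hu => (norm_cpow_mul_exp_neg_mul hu w z).le)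

theorem differentiableAt_integral_cpow_mul_exp_neg_mul {w z : ℂ} (hw : -1 < w.re) (hz : 0 < z.re) :
    DifferentiableAt ℂ (fun z : ℂ => ∫ u in Ioi (0 : ℝ), (u : ℂ) ^ w * exp (-z * u)) z := by
  have hmeas : ∀ v : ℂ, AEStronglyMeasurable (fun u : ℝ => (u : ℂ) ^ w * exp (-v * u))
      (volume.restrict (Ioi 0)) := fun v =>
    (continuousOn_cpow_mul_exp_neg_mul w v).aestronglyMeasurable measurableSet_Ioi
  refine (hasDerivAt_integral_of_dominated_loc_of_deriv_le
    (F := fun z (u : ℝ) => (u : ℂ) ^ w * exp (-z * u))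
    (F' := fun z (u : ℝ) => (u : ℂ) ^ w * exp (-z * u) * (-u))
    (bound := fun u => u ^ (w.re + 1) * Real.exp (-(z.re / 2) * u))
    (Metric.ball_mem_nhds z (half_pos hz)) (Eventually.of_forall hmeas)
    (integrableOn_cpow_mul_exp_neg_mul hw hz) ?_ ?_
    (integrableOn_rpow_mul_exp_neg_mul (by linarith) (half_pos hz)) ?_).2.differentiableAt
  · exact (hmeas z).mul (Continuous.aestronglyMeasurable (by fun_prop))
  · refine (ae_restrict_iff' measurableSet_Ioi).2 (ae_of_all _ fun u (hu : 0 < u) v hv => ?_)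
    rw [norm_mul, norm_cpow_mul_exp_neg_mul hu, norm_neg, norm_real, Real.norm_of_nonneg hu.le,
      Real.rpow_add_one hu.ne', mul_right_comm]
    have h1 : z.re / 2 ≤ v.re := by
      have h2 : ‖v - z‖ < z.re / 2 := by simpa [dist_eq_norm] using hv
      have h3 := (abs_le.1 ((abs_re_le_norm (v - z)).trans h2.le)).1
      simp at h3
      linarith
    refine mul_le_mul_of_nonneg_left (Real.exp_le_exp.2 ?_) (by positivity)
    nlinarith
  · refine ae_of_all _ fun u v _ => ?_
    have h1 : HasDerivAt (fun v : ℂ => -v * u) (-u) v := by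
      simpa using (hasDerivAt_id v).neg.mul_const (u : ℂ)
    exact (h1.cexp.const_mul ((u : ℂ) ^ w)).congr_deriv (by ring)

/-- Euler's integral with a complex scale in the right half plane. -/
theorem integral_cpow_mul_exp_neg_mul {w z : ℂ} (hw : 0 < w.re) (hz : 0 < z.re) :
    ∫ u in Ioi (0 : ℝ), (u : ℂ) ^ (w - 1) * exp (-z * u) = z ^ (-w) * Gamma w := by
  have hopen : IsOpen {z : ℂ | 0 < z.re} := isOpen_lt continuous_const continuous_re
  have h1 : AnalyticOnNhd ℂ (fun z : ℂ => ∫ u in Ioi (0 : ℝ), (u : ℂ) ^ (w - 1) * exp (-z * u))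
      {z : ℂ | 0 < z.re} :=
    DifferentiableOn.analyticOnNhd (fun z hz =>
      (differentiableAt_integral_cpow_mul_exp_neg_mul (by simp; linarith)
        hz).differentiableWithinAt) hopen
  have h2 : AnalyticOnNhd ℂ (fun z : ℂ => z ^ (-w) * Gamma w) {z : ℂ | 0 < z.re} :=
    DifferentiableOn.analyticOnNhd (fun z hz => by
      have : z ∈ slitPlane := Or.inl hz
      exact (((differentiableAt_id.cpow_const this)).mul_const _).differentiableWithinAt) hopen
  refine h1.eqOn_of_preconnected_of_frequently_eq h2
    (convex_halfSpace_re_gt 0).isPreconnected (show (1 : ℂ) ∈ {z : ℂ | 0 < z.re} by simp) ?_ hz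
  -- Both sides are analytic in the scale; they agree on real scales, which accumulate at 1 from the
  -- right.
  have htend : Tendsto (fun x : ℝ => (x : ℂ)) (𝓝[>] 1) (𝓝[≠] 1) := by
    refine tendsto_nhdsWithin_iff.2 ⟨?_, ?_⟩
    · exact (continuous_ofReal.tendsto' 1 1 (by simp)).mono_left nhdsWithin_le_nhds
    · filter_upwards [self_mem_nhdsWithin] with x (hx : 1 < x)
      simp only [mem_compl_iff, mem_singleton_iff]
      exact_mod_cast hx.ne'
  refine htend.frequently (Eventually.frequently ?_)
  filter_upwards [self_mem_nhdsWithin] with x (hx : 1 < x)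
  have hx0 : 0 < x := by linarith
  have := integral_cpow_mul_exp_neg_mul_Ioi hw hx0
  rw [one_div, inv_cpow _ _ (by rw [arg_ofReal_of_nonneg hx0.le]; exact Real.pi_pos.ne),
    ← cpow_neg] at this
  rw [← this]
  simp only [neg_mul]

end GammaIntegral

/-! ### Partial fractions and the sine transform of the Fermi weight. -/

section HyperbolicSine

theorem HasSum.of_forall_eq {f g : ℕ → ℂ} {a b : ℂ} (h : HasSum f a) (hf : ∀ n, g n = f n)
    (hb : b = a) : HasSum g b := by
  rwa [hb, funext hf]

/-- This is the partial fraction expansion of π cot(πz) at z = iv, multiplied by i. -/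
theorem hasSum_coth_series {v : ℝ} (hv : 0 < v) :
    HasSum (fun n : ℕ => 2 * (v : ℂ) / ((v : ℂ) ^ 2 + (n + 1) ^ 2))
      (Real.pi * (1 + exp (-(2 * Real.pi * v))) / (1 - exp (-(2 * Real.pi * v))) - 1 / v) := by
  have hmem : I * (v : ℂ) ∈ integerComplement := by
    rw [mem_integerComplement_iff]
    rintro ⟨n, hn⟩
    have := congrArg im hn
    simp at this
    linarith
  have h1 := (summable_cotTerm hmem).hasSum
  rw [← cot_series_rep' hmem] at h1
  have h2 := h1.mul_left I
  have hvC : (v : ℂ) ≠ 0 := by exact_mod_cast hv.ne'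
  have hexp : exp (2 * Real.pi * I * (I * v)) = exp (-(2 * Real.pi * v)) := by
    congr 1
    linear_combination (2 * Real.pi * v : ℂ) * I_sq
  refine h2.of_forall_eq (fun n => ?_) ?_
  · have hsq : (v : ℂ) ^ 2 + (n + 1) ^ 2 ≠ 0 := by
      have : 0 < v ^ 2 + ((n : ℝ) + 1) ^ 2 := by positivity
      exact_mod_cast this.ne'
    have hf : (v : ℂ) ^ 2 + (n + 1) ^ 2 = -((I * v - (n + 1)) * (I * v + (n + 1))) := by
      linear_combination ((v : ℂ) ^ 2) * I_sq
    rw [hf] at hsq ⊢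
    have ha : I * (v : ℂ) - (n + 1) ≠ 0 := fun h => hsq (by rw [h]; ring)
    have hb : I * (v : ℂ) + (n + 1) ≠ 0 := fun h => hsq (by rw [h]; ring)
    rw [cotTerm, div_add_div _ _ ha hb, mul_div_assoc', div_neg, ← neg_div]
    congr 1
    linear_combination (-2 * v : ℂ) * I_sq
  · rw [cot_pi_eq_exp_ratio, hexp]
    have h3 : (1 : ℂ) - exp (-(2 * Real.pi * v)) ≠ 0 := by
      have : Real.exp (-(2 * Real.pi * v)) < 1 := by
        rw [Real.exp_lt_one_iff]; have := Real.pi_pos; simp; positivity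
      have h4 : (1 : ℝ) - Real.exp (-(2 * Real.pi * v)) ≠ 0 := by linarith
      exact_mod_cast h4
    field_simp
    ring

/-- The alternating series for `1 / sinh`. -/
theorem hasSum_csch_series {u : ℝ} (hu : 0 < u) :
    HasSum (fun n : ℕ => (-1 : ℂ) ^ n * (u / ((u : ℂ) ^ 2 + (2 * Real.pi * (n + 1)) ^ 2)))
      (1 / (2 * u) - exp (-(u / 2)) / (2 * (1 - exp (-(u / 2)) ^ 2))) := by
  set v := u / (2 * Real.pi) with hv
  have hpi := Real.pi_pos
  have hv0 : 0 < v := by positivity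
  have hpiC : (Real.pi : ℂ) ≠ 0 := by exact_mod_cast hpi.ne'
  have huC : (u : ℂ) ≠ 0 := by exact_mod_cast hu.ne'
  have hvu : (v : ℂ) = u / (2 * Real.pi) := by rw [hv]; push_cast; ring
  have hA := hasSum_coth_series hv0
  have hB := hasSum_coth_series (half_pos hv0)
  set a : ℕ → ℂ := fun n => 2 * (v : ℂ) / ((v : ℂ) ^ 2 + (n + 1) ^ 2) with ha
  -- The index n stands for the integer n + 1, so odd indices carry the even integers: they form
  -- half of the same series at v/2. The alternating sum is then the full sum minus twice this one.
  have hodd : HasSum (fun m => a (2 * m + 1))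
      (1 / 2 * (Real.pi * (1 + exp (-(2 * Real.pi * (v / 2 : ℝ)))) /
        (1 - exp (-(2 * Real.pi * (v / 2 : ℝ)))) - 1 / (v / 2 : ℝ))) := by
    refine (hB.mul_left (1 / 2)).of_forall_eq (fun m => ?_) rfl
    have h1 : ((v / 2 : ℝ) : ℂ) ^ 2 + (m + 1) ^ 2 ≠ 0 := by
      have : 0 < (v / 2) ^ 2 + ((m : ℝ) + 1) ^ 2 := by positivity
      exact_mod_cast this.ne'
    have h2 : (v : ℂ) ^ 2 + ((2 * m + 1 : ℕ) + 1) ^ 2 =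
        4 * (((v / 2 : ℝ) : ℂ) ^ 2 + (m + 1) ^ 2) := by
      push_cast; ring
    simp only [ha]
    rw [h2]
    push_cast at h1 ⊢
    field_simp
    ring
  have heven : HasSum (fun m => a (2 * m)) (Real.pi * (1 + exp (-(2 * Real.pi * v))) /
      (1 - exp (-(2 * Real.pi * v))) - 1 / v -
      (1 / 2 * (Real.pi * (1 + exp (-(2 * Real.pi * (v / 2 : ℝ)))) /
        (1 - exp (-(2 * Real.pi * (v / 2 : ℝ)))) - 1 / (v / 2 : ℝ)))) := by
    have hs : Summable fun m => a (2 * m) :=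
      hA.summable.comp_injective (mul_right_injective₀ (two_ne_zero' ℕ))
    have := (hs.hasSum.even_add_odd hodd).unique hA
    rw [← this, add_sub_cancel_right]
    exact hs.hasSum
  have halt := HasSum.even_add_odd (f := fun n => (-1 : ℂ) ^ n * a n)
    (heven.of_forall_eq (fun m => by simp [pow_mul]) rfl)
    (hodd.neg.of_forall_eq (fun m => by simp [pow_add, pow_mul]) rfl)
  refine (halt.mul_left (1 / (4 * Real.pi : ℂ))).of_forall_eq (fun n => ?_) ?_
  · have h1 : (u : ℂ) ^ 2 + (2 * Real.pi * (n + 1)) ^ 2 ≠ 0 := by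
      have : 0 < u ^ 2 + (2 * Real.pi * ((n : ℝ) + 1)) ^ 2 := by positivity
      exact_mod_cast this.ne'
    have h2 : (v : ℂ) ^ 2 + (n + 1) ^ 2 =
        ((u : ℂ) ^ 2 + (2 * Real.pi * (n + 1)) ^ 2) / (4 * Real.pi ^ 2) := by
      rw [hvu]; field_simp; ring
    simp only [ha]
    rw [h2, hvu]
    field_simp
  · have e1 : exp (-(2 * Real.pi * ((v / 2 : ℝ) : ℂ))) = exp (-(u / 2)) := by
      congr 1; push_cast; rw [hvu]; field_simp
    have e2 : exp (-(2 * Real.pi * (v : ℂ))) = exp (-(u / 2)) ^ 2 := by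
      rw [← exp_nat_mul]; congr 1; rw [hvu]; push_cast; field_simp
    rw [e1, e2]
    have h4 : (1 : ℂ) - exp (-(u / 2)) ≠ 0 ∧ (1 : ℂ) + exp (-(u / 2)) ≠ 0 := by
      have h5 : Real.exp (-(u / 2)) < 1 := by rw [Real.exp_lt_one_iff]; linarith
      have h6 : (1 : ℝ) - Real.exp (-(u / 2)) ≠ 0 := by linarith
      have h7 : (1 : ℝ) + Real.exp (-(u / 2)) ≠ 0 := by have := Real.exp_pos (-(u / 2)); linarith
      exact ⟨by exact_mod_cast h6, by exact_mod_cast h7⟩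
    set p := exp (-((u : ℂ) / 2)) with hp
    have h8 : 1 - p ^ 2 ≠ 0 := by
      rw [show 1 - p ^ 2 = (1 - p) * (1 + p) by ring]; exact mul_ne_zero h4.1 h4.2
    push_cast
    rw [hvu, show (1 - p ^ 2) = (1 - p) * (1 + p) by ring]
    have h9 := h4.1
    have h10 := h4.2
    field_simp
    ring

theorem integral_exp_neg_mul_sin {a u : ℝ} (ha : 0 < a) :
    ∫ x in Ioi (0 : ℝ), exp (-(a * x)) * sin (u * x) = u / ((u : ℂ) ^ 2 + a ^ 2) := by
  have h1 : ∀ x : ℝ, exp (-(a * x)) * sin (u * x) =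
      I / 2 * exp ((-a - u * I) * x) - I / 2 * exp ((-a + u * I) * x) := by
    intro x
    have e1 : exp ((-a - u * I) * x) = exp (-(a * x)) * exp (-(u * x) * I) := by
      rw [← exp_add]; congr 1; ring
    have e2 : exp ((-a + u * I) * x) = exp (-(a * x)) * exp ((u * x) * I) := by
      rw [← exp_add]; congr 1; ring
    rw [e1, e2, sin]
    ring
  have hr1 : ((-a - u * I : ℂ)).re < 0 := by simpa using ha
  have hr2 : ((-a + u * I : ℂ)).re < 0 := by simpa using ha
  simp_rw [h1]
  rw [integral_sub ((integrableOn_exp_mul_complex_Ioi hr1 0).const_mul _)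
    ((integrableOn_exp_mul_complex_Ioi hr2 0).const_mul _), integral_const_mul, integral_const_mul,
    integral_exp_mul_complex_Ioi hr1, integral_exp_mul_complex_Ioi hr2]
  have n1 : (-a - u * I : ℂ) ≠ 0 := fun h => by simp [h] at hr1
  have n2 : (-a + u * I : ℂ) ≠ 0 := fun h => by simp [h] at hr2
  have n3 : (u : ℂ) ^ 2 + a ^ 2 = (-a - u * I) * (-a + u * I) := by
    linear_combination (u : ℂ) ^ 2 * I_sq
  simp only [ofReal_zero, mul_zero, exp_zero]
  rw [n3, ← mul_sub, div_sub_div _ _ n1 n2, mul_div_assoc']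
  congr 1
  linear_combination (-u : ℂ) * I_sq

theorem hasSum_inv_exp_two_pi_add_one {x : ℝ} (hx : 0 < x) :
    HasSum (fun n : ℕ => (-1 : ℂ) ^ n * exp (-((2 * Real.pi * (n + 1) : ℝ) * x))) (fermiWeight 0 x) := by
  have hlt : ‖-exp (-(2 * Real.pi * x))‖ < 1 := by
    rw [norm_neg, norm_exp]
    have := Real.pi_pos
    have h : 0 < 2 * Real.pi * x := by positivity
    simpa using h
  have := (hasSum_geometric_of_norm_lt_one hlt).mul_left (exp (-(2 * Real.pi * x)))
  refine this.of_forall_eq (fun n => ?_) ?_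
  · rw [neg_pow (exp _), ← exp_nat_mul, mul_left_comm, ← exp_add]
    congr 2
    push_cast
    ring
  · unfold fermiWeight
    push_cast
    rw [exp_neg, sub_neg_eq_add, pow_zero, one_mul]
    have h0 := exp_ne_zero (2 * Real.pi * x)
    have h1 : exp (2 * Real.pi * x) + 1 ≠ 0 := by
      have : 0 < Real.exp (2 * Real.pi * x) + 1 := by positivity
      exact_mod_cast this.ne'
    have h2 : 1 + (exp (2 * Real.pi * x))⁻¹ ≠ 0 := by
      intro h
      apply h1
      field_simp at h
      rwa [mul_zero] at h
    field_simp

/-- Expand the weight in a geometric series, integrate termwise, and sum the resulting partial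
fractions with `hasSum_csch_series`. -/
theorem integral_sin_mul_fermiWeight {u : ℝ} (hu : 0 < u) :
    ∫ x in Ioi (0 : ℝ), fermiWeight 0 x * sin (u * x) =
      1 / (2 * u) - exp (-(u / 2)) / (2 * (1 - exp (-(u / 2)) ^ 2)) := by
  have hpi := Real.pi_pos
  set F : ℕ → ℝ → ℂ := fun n x =>
    (-1 : ℂ) ^ n * exp (-((2 * Real.pi * (n + 1) : ℝ) * x)) * sin (u * x) with hF
  have hapos : ∀ n : ℕ, 0 < 2 * Real.pi * ((n : ℝ) + 1) := fun n => by positivity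
  -- Using |sin(ux)| ≤ ux rather than 1 bounds the n-th integral by a multiple of 1/(n+1)², which is
  -- summable; the bound 1 would only give 1/(n+1).
  have hbd : ∀ (n : ℕ) (x : ℝ), 0 < x →
      ‖F n x‖ ≤ u * (x ^ (2 - 1 : ℝ) * Real.exp (-(2 * Real.pi * ((n : ℝ) + 1) * x))) := by
    intro n x hx
    have h1 : ‖sin ((u : ℂ) * x)‖ ≤ u * x := by
      rw [← ofReal_mul, ← ofReal_sin, norm_real, Real.norm_eq_abs]
      exact (Real.abs_sin_le_abs).trans_eq (abs_of_pos (by positivity))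
    simp only [hF]
    rw [norm_mul, norm_mul, norm_pow, norm_neg, norm_one, one_pow, one_mul, norm_exp]
    norm_num
    rw [mul_comm]
    calc _ ≤ u * x * _ := mul_le_mul_of_nonneg_right h1 (Real.exp_nonneg _)
      _ = _ := by ring
  have hbi : ∀ n : ℕ, IntegrableOn (fun x : ℝ =>
      u * (x ^ (2 - 1 : ℝ) * Real.exp (-(2 * Real.pi * ((n : ℝ) + 1) * x)))) (Ioi 0) := by
    intro n
    have := (integrableOn_rpow_mul_exp_neg_mul (a := 2 - 1) (by norm_num) (hapos n)).const_mul u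
    simpa only [neg_mul, IntegrableOn] using this
  have hFi : ∀ n, IntegrableOn (F n) (Ioi 0) := fun n => by
    refine Integrable.mono' (hbi n) (Continuous.aestronglyMeasurable (by fun_prop)) ?_
    exact (ae_restrict_iff' measurableSet_Ioi).2 (ae_of_all _ fun x hx => hbd n x hx)
  have hsum : Summable fun n => ∫ x in Ioi (0 : ℝ), ‖F n x‖ := by
    have h2 : Summable fun n : ℕ => u / (2 * Real.pi) ^ 2 * (1 / ((n : ℝ) + 1) ^ 2) := by
      refine Summable.mul_left _ ?_
      exact_mod_cast (summable_nat_add_iff 1).2 (Real.summable_one_div_nat_pow.2 one_lt_two)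
    refine Summable.of_nonneg_of_le (fun n => integral_nonneg fun x => norm_nonneg _)
      (fun n => ?_) h2
    calc ∫ x in Ioi (0 : ℝ), ‖F n x‖ ≤ ∫ x in Ioi (0 : ℝ),
          u * (x ^ (2 - 1 : ℝ) * Real.exp (-(2 * Real.pi * ((n : ℝ) + 1) * x))) :=
          setIntegral_mono_on (hFi n).norm (hbi n) measurableSet_Ioi fun x hx => hbd n x hx
      _ = _ := by
          rw [integral_const_mul, Real.integral_rpow_mul_exp_neg_mul_Ioi two_pos (hapos n),
            Real.Gamma_two]
          norm_num
          field_simp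
  have h3 := hasSum_integral_of_summable_integral_norm hFi hsum
  have h4 : ∀ n, ∫ x in Ioi (0 : ℝ), F n x =
      (-1 : ℂ) ^ n * (u / ((u : ℂ) ^ 2 + (2 * Real.pi * (n + 1)) ^ 2)) := by
    intro n
    simp only [hF, mul_assoc]
    rw [integral_const_mul]
    have := integral_exp_neg_mul_sin (u := u) (hapos n)
    push_cast at this ⊢
    simp only [mul_assoc] at this ⊢
    rw [this]
  have h5 : ∫ x in Ioi (0 : ℝ), ∑' n, F n x =
      ∫ x in Ioi (0 : ℝ), fermiWeight 0 x * sin (u * x) := by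
    refine setIntegral_congr_fun measurableSet_Ioi fun x hx => ?_
    exact ((hasSum_inv_exp_two_pi_add_one hx).mul_right _).tsum_eq
  simp_rw [h4] at h3
  rw [h5] at h3
  exact h3.unique (hasSum_csch_series hu)

end HyperbolicSine

/-! ### Hermite's formula and the logarithm of the Milnor gamma function. -/

section HurwitzZeta

theorem cpow_neg_eq_exp {z : ℂ} (hz : 0 < z.re) (w : ℂ) : z ^ (-w) = exp (-w * log z) := by
  rw [cpow_def_of_ne_zero (by rintro rfl; simp at hz), mul_comm]

theorem hasSum_integral_hurwitz {w s : ℂ} (hw : 1 < w.re) (hs : 0 < s.re) :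
    HasSum (fun n : ℕ => ((n : ℂ) + s) ^ (-w) * Gamma w)
      (∫ u in Ioi (0 : ℝ), ∑' n : ℕ, (u : ℂ) ^ (w - 1) * exp (-((n : ℂ) + s) * u)) := by
  have hre : ∀ n : ℕ, 0 < ((n : ℂ) + s).re := fun n => by
    simp only [add_re, natCast_re]; positivity
  have hre' : ∀ n : ℕ, 0 < (n : ℝ) + s.re := fun n => by positivity
  have hint : ∀ n : ℕ, IntegrableOn (fun u : ℝ => (u : ℂ) ^ (w - 1) * exp (-((n : ℂ) + s) * u))
      (Ioi 0) := fun n =>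
    integrableOn_cpow_mul_exp_neg_mul (by simp; linarith) (hre n)
  have hnorm : ∀ n : ℕ, ∫ u in Ioi (0 : ℝ), ‖(u : ℂ) ^ (w - 1) * exp (-((n : ℂ) + s) * u)‖ =
      1 / |(n : ℝ) + s.re| ^ w.re * Real.Gamma w.re := by
    intro n
    have h1 := Real.integral_rpow_mul_exp_neg_mul_Ioi (a := w.re) (by linarith) (hre' n)
    rw [abs_of_pos (hre' n), ← Real.one_rpow w.re, ← Real.div_rpow zero_le_one (hre' n).le, ← h1]
    refine setIntegral_congr_fun measurableSet_Ioi fun u hu => ?_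
    rw [norm_cpow_mul_exp_neg_mul hu]
    simp only [sub_re, one_re, add_re, natCast_re, neg_mul]
  have hsum : Summable fun n : ℕ =>
      ∫ u in Ioi (0 : ℝ), ‖(u : ℂ) ^ (w - 1) * exp (-((n : ℂ) + s) * u)‖ := by
    simp_rw [hnorm]
    exact ((Real.summable_one_div_nat_add_rpow s.re w.re).2 hw).mul_right _
  have h := hasSum_integral_of_summable_integral_norm hint hsum
  refine h.of_forall_eq (fun n => ?_) rfl
  rw [integral_cpow_mul_exp_neg_mul (by linarith) (hre n)]

theorem summable_hurwitzSeries {w s : ℂ} (hw : 1 < w.re) (hs : 0 < s.re) :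
    Summable fun n : ℕ => ((n : ℂ) + s) ^ (-w) := by
  have h := (hasSum_integral_hurwitz hw hs).summable.mul_right (Gamma w)⁻¹
  refine h.congr fun n => ?_
  rw [mul_assoc, mul_inv_cancel₀ (Gamma_ne_zero_of_re_pos (by linarith)), mul_one]

/-- The geometric series gives e^{-u/2}/(1-e^{-u}) = 1/(2 sinh(u/2)). The shift 1/2 is what produces
1/sinh, and with it the weight 1/(e^{2πx}+1) coming from tanh. -/
theorem tsum_exp_neg_mul {t : ℂ} {u : ℝ} (hu : 0 < u) (w : ℂ) :
    ∑' n : ℕ, (u : ℂ) ^ (w - 1) * exp (-((n : ℂ) + (t + 1 / 2)) * u) =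
      (u : ℂ) ^ (w - 1 - 1) * exp (-t * u) -
        2 * ∫ x in Ioi (0 : ℝ), (u : ℂ) ^ (w - 1) * exp (-t * u) *
          (fermiWeight 0 x * sin (u * x)) := by
  have huC : (u : ℂ) ≠ 0 := by exact_mod_cast hu.ne'
  have hlt : ‖exp (-(u : ℂ))‖ < 1 := by
    rw [norm_exp]; simpa using hu
  have h1 : ∀ n : ℕ, (u : ℂ) ^ (w - 1) * exp (-((n : ℂ) + (t + 1 / 2)) * u) =
      (u : ℂ) ^ (w - 1) * exp (-t * u) * exp (-(u / 2)) * exp (-(u : ℂ)) ^ n := by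
    intro n
    rw [← exp_nat_mul, mul_assoc _ (exp (-t * u)), ← exp_add, mul_assoc, ← exp_add]
    congr 2
    ring
  have h2 : exp (-(u : ℂ)) = exp (-(u / 2)) ^ 2 := by
    rw [← exp_nat_mul]; congr 1; push_cast; ring
  simp_rw [h1]
  rw [tsum_mul_left, tsum_geometric_of_norm_lt_one hlt, integral_const_mul,
    integral_sin_mul_fermiWeight hu, h2, cpow_sub (w - 1) 1 huC, cpow_one]
  have h3 : 1 - exp (-((u : ℂ) / 2)) ^ 2 ≠ 0 := by
    rw [← h2]
    intro h
    rw [← sub_eq_zero.1 h] at hlt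
    simp at hlt
  field_simp
  ring

/-- Needed for Fubini. Since |sin| ≤ 1 for real arguments, a product of integrable functions of u
and of x dominates. -/
theorem integrable_cpow_mul_sin_mul_fermiWeight {w t : ℂ} (hw : 1 < w.re) (ht : 0 < t.re) :
    Integrable (Function.uncurry fun u x : ℝ =>
      (u : ℂ) ^ (w - 1) * exp (-t * u) * (fermiWeight 0 x * sin (u * x)))
      ((volume.restrict (Ioi 0)).prod (volume.restrict (Ioi 0))) := by
  have h1 := integrableOn_cpow_mul_exp_neg_mul (w := w - 1) (z := t) (by simp; linarith) ht
  have h2 : IntegrableOn (fermiWeight 0) (Ioi 0) := by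
    refine Integrable.mono (integrableOn_exp_mul_fermiWeight 0)
      (continuous_fermiWeight 0).aestronglyMeasurable ?_
    refine (ae_restrict_iff' measurableSet_Ioi).2 (ae_of_all _ fun x (hx : 0 < x) => ?_)
    rw [norm_mul, norm_norm, Real.norm_of_nonneg (Real.exp_nonneg x)]
    exact le_mul_of_one_le_left (norm_nonneg _) (Real.one_le_exp hx.le)
  have h3 := Integrable.mul_prod h1 h2
  have h4 : Continuous fun z : ℝ × ℝ => sin ((z.1 : ℂ) * z.2) := by fun_prop
  refine Integrable.mono h3 ?_ (ae_of_all _ fun z => ?_)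
  · refine (h3.aestronglyMeasurable.mul h4.aestronglyMeasurable).congr (ae_of_all _ fun z => ?_)
    simp only [Function.uncurry, Pi.mul_apply]
    ring
  · have h5 : ‖sin ((z.1 : ℂ) * z.2)‖ ≤ 1 := by
      rw [← ofReal_mul, ← ofReal_sin, norm_real]
      exact Real.abs_sin_le_one _
    simp only [Function.uncurry]
    rw [← mul_assoc, norm_mul _ (sin _)]
    exact mul_le_of_le_one_right (norm_nonneg _) h5

theorem integral_cpow_mul_exp_mul_sin {w t : ℂ} (hw : 1 < w.re) (ht : 0 < t.re) (x : ℝ) :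
    ∫ u in Ioi (0 : ℝ), (u : ℂ) ^ (w - 1) * exp (-t * u) * sin (u * x) =
      I / 2 * (exp (-w * log (t + x * I)) - exp (-w * log (t - x * I))) * Gamma w := by
  have hp : 0 < (t + x * I).re := by simpa using ht
  have hm : 0 < (t - x * I).re := by simpa using ht
  have h1 : ∀ u : ℝ, (u : ℂ) ^ (w - 1) * exp (-t * u) * sin (u * x) =
      I / 2 * ((u : ℂ) ^ (w - 1) * exp (-(t + x * I) * u)) -
        I / 2 * ((u : ℂ) ^ (w - 1) * exp (-(t - x * I) * u)) := by
    intro u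
    have e1 : exp (-(t + x * I) * u) = exp (-t * u) * exp (-(u * x) * I) := by
      rw [← exp_add]; congr 1; ring
    have e2 : exp (-(t - x * I) * u) = exp (-t * u) * exp (u * x * I) := by
      rw [← exp_add]; congr 1; ring
    rw [e1, e2, sin]
    ring
  have hw' : -1 < (w - 1).re := by simp; linarith
  simp_rw [h1]
  rw [integral_sub ((integrableOn_cpow_mul_exp_neg_mul hw' hp).const_mul _)
    ((integrableOn_cpow_mul_exp_neg_mul hw' hm).const_mul _), integral_const_mul,
    integral_const_mul, integral_cpow_mul_exp_neg_mul (by linarith) hp,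
    integral_cpow_mul_exp_neg_mul (by linarith) hm, cpow_neg_eq_exp hp, cpow_neg_eq_exp hm]
  ring

variable {t : ℂ}

/-- The integral `∫ (t + i x)^(-w) / (e^(2πx) + 1) dx`. -/
noncomputable def upperFermi (t w : ℂ) : ℂ :=
  ∫ x in Ioi (0 : ℝ), exp (-w * log (t + x * I)) * fermiWeight 0 x

/-- The integral `∫ (t - i x)^(-w) / (e^(2πx) + 1) dx`. -/
noncomputable def lowerFermi (t w : ℂ) : ℂ :=
  ∫ x in Ioi (0 : ℝ), exp (-w * log (t - x * I)) * fermiWeight 0 x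

theorem hasDerivAt_upperFermi (ht : 0 < t.re) (w : ℂ) :
    IntegrableOn (fun x : ℝ => exp (-w * log (t + x * I)) * fermiWeight 0 x) (Ioi 0) ∧
    IntegrableOn (fun x : ℝ => -log (t + x * I) * exp (-w * log (t + x * I)) * fermiWeight 0 x)
      (Ioi 0) ∧
    HasDerivAt (upperFermi t) (∫ x in Ioi (0 : ℝ), -log (t + x * I) *
      exp (-w * log (t + x * I)) * fermiWeight 0 x) w :=
  hasDerivAt_integral_exp_neg_mul (continuous_log_add_mul_I ht).continuousOn
    (continuous_fermiWeight _).continuousOn (log_add_mul_I_growth ht)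
    (integrableOn_exp_mul_fermiWeight _) w

theorem hasDerivAt_lowerFermi (ht : 0 < t.re) (w : ℂ) :
    IntegrableOn (fun x : ℝ => exp (-w * log (t - x * I)) * fermiWeight 0 x) (Ioi 0) ∧
    IntegrableOn (fun x : ℝ => -log (t - x * I) * exp (-w * log (t - x * I)) * fermiWeight 0 x)
      (Ioi 0) ∧
    HasDerivAt (lowerFermi t) (∫ x in Ioi (0 : ℝ), -log (t - x * I) *
      exp (-w * log (t - x * I)) * fermiWeight 0 x) w :=
  hasDerivAt_integral_exp_neg_mul (continuous_log_sub_mul_I ht).continuousOn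
    (continuous_fermiWeight _).continuousOn (log_sub_mul_I_growth ht)
    (integrableOn_exp_mul_fermiWeight _) w

/-- Hermite's formula for the Hurwitz zeta function, centred at the midpoint `1/2`. -/
noncomputable def hermiteFormula (t w : ℂ) : ℂ :=
  exp ((1 - w) * log t) / (w - 1) + I * (lowerFermi t w - upperFermi t w)

/-- Multiply by Γ(w) and write the series as a Mellin integral. The 1/u part gives t^{1-w} Γ(w-1) =
t^{1-w} Γ(w)/(w-1); in the sine part, swapping the integrals leaves Euler integrals with scales t ±
ix. -/
theorem hurwitzSeries_eq_hermiteFormula (ht : 0 < t.re) {w : ℂ} (hw : 1 < w.re) :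
    hurwitzSeries w (t + 1 / 2) = hermiteFormula t w := by
  have hw1 : w - 1 ≠ 0 := fun h => by
    have := congrArg re h
    simp at this
    linarith
  have hG : Gamma w ≠ 0 := Gamma_ne_zero_of_re_pos (by linarith)
  have hGw : Gamma w = (w - 1) * Gamma (w - 1) := by
    rw [← Gamma_add_one _ hw1, sub_add_cancel]
  have h1 := (hasSum_integral_hurwitz (s := t + 1 / 2) hw (by simp; linarith)).tsum_eq
  rw [tsum_mul_right] at h1
  have h2 : ∫ u in Ioi (0 : ℝ), ∑' n : ℕ, (u : ℂ) ^ (w - 1) * exp (-((n : ℂ) + (t + 1 / 2)) * u) =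
      ∫ u in Ioi (0 : ℝ), ((u : ℂ) ^ (w - 1 - 1) * exp (-t * u) -
        2 * ∫ x in Ioi (0 : ℝ), (u : ℂ) ^ (w - 1) * exp (-t * u) *
          (fermiWeight 0 x * sin (u * x))) :=
    setIntegral_congr_fun measurableSet_Ioi fun u hu => tsum_exp_neg_mul hu w
  have hprod := integrable_cpow_mul_sin_mul_fermiWeight hw ht
  have h3 : ∫ u in Ioi (0 : ℝ), ∫ x in Ioi (0 : ℝ), (u : ℂ) ^ (w - 1) * exp (-t * u) *
      (fermiWeight 0 x * sin (u * x)) = I / 2 * (upperFermi t w - lowerFermi t w) * Gamma w := by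
    rw [integral_integral_swap hprod]
    have h4 : ∀ x : ℝ, ∫ u in Ioi (0 : ℝ), (u : ℂ) ^ (w - 1) * exp (-t * u) *
        (fermiWeight 0 x * sin (u * x)) =
        I / 2 * Gamma w * (exp (-w * log (t + x * I)) * fermiWeight 0 x -
          exp (-w * log (t - x * I)) * fermiWeight 0 x) := by
      intro x
      simp_rw [mul_left_comm _ (fermiWeight 0 x)]
      rw [integral_const_mul, integral_cpow_mul_exp_mul_sin hw ht]
      ring
    simp_rw [h4]
    rw [integral_const_mul, integral_sub (hasDerivAt_upperFermi ht w).1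
      (hasDerivAt_lowerFermi ht w).1, upperFermi, lowerFermi]
    ring
  have hinner : IntegrableOn (fun u : ℝ => ∫ x in Ioi (0 : ℝ), (u : ℂ) ^ (w - 1) * exp (-t * u) *
      (fermiWeight 0 x * sin (u * x))) (Ioi 0) := hprod.integral_prod_left
  have hw' : 0 < (w - 1).re := by simp; linarith
  rw [h2, integral_sub (integrableOn_cpow_mul_exp_neg_mul (by simp; linarith) ht)
    (hinner.const_mul 2), integral_const_mul, h3,
    integral_cpow_mul_exp_neg_mul hw' ht, cpow_neg_eq_exp ht] at h1
  rw [hurwitzSeries, hermiteFormula, ← mul_left_inj' hG, h1, add_mul, div_mul_eq_mul_div, hGw,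
    neg_sub]
  field_simp
  ring

theorem analyticAt_lowerFermi_sub_upperFermi (ht : 0 < t.re) (w : ℂ) :
    AnalyticAt ℂ (fun w => I * (lowerFermi t w - upperFermi t w)) w := by
  have hd : Differentiable ℂ (fun w => I * (lowerFermi t w - upperFermi t w)) := fun w =>
    ((hasDerivAt_lowerFermi ht w).2.2.differentiableAt.sub
      (hasDerivAt_upperFermi ht w).2.2.differentiableAt).const_mul I
  exact hd.analyticAt w

theorem analyticAt_hermiteFormula (ht : 0 < t.re) {w : ℂ} (hw : w ≠ 1) :
    AnalyticAt ℂ (hermiteFormula t) w := by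
  refine AnalyticAt.add (AnalyticAt.div (by fun_prop) (by fun_prop) (sub_ne_zero.2 hw))
    (analyticAt_lowerFermi_sub_upperFermi ht w)

theorem meromorphicOn_hermiteFormula (ht : 0 < t.re) : MeromorphicOn (hermiteFormula t) univ :=
  fun w _ => MeromorphicAt.add (MeromorphicAt.div (AnalyticAt.meromorphicAt (by fun_prop))
    (AnalyticAt.meromorphicAt (by fun_prop)))
    (analyticAt_lowerFermi_sub_upperFermi ht w).meromorphicAt

theorem hermiteFormula_halfPlane (ht : 0 < t.re) (w : ℂ) (hw : 1 < w.re) :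
    AnalyticAt ℂ (hermiteFormula t) w ∧ hermiteFormula t w = hurwitzSeries w (t + 1 / 2) :=
  ⟨analyticAt_hermiteFormula ht (by rintro rfl; simp at hw),
    (hurwitzSeries_eq_hermiteFormula ht hw).symm⟩

theorem isMeromorphicContinuation_hurwitzZetaFunction (ht : 0 < t.re) :
    IsMeromorphicContinuation (fun w => hurwitzSeries w (t + 1 / 2)) 1
      (fun w => hurwitzZetaFunction w (t + 1 / 2)) :=
  isMeromorphicContinuation_meromorphicContinuation (meromorphicOn_hermiteFormula ht)
    (hermiteFormula_halfPlane ht)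

theorem hurwitzZetaFunction_eventuallyEq (ht : 0 < t.re) {w : ℂ} (hw : w ≠ 1) :
    (fun w => hurwitzZetaFunction w (t + 1 / 2)) =ᶠ[𝓝 w] hermiteFormula t :=
  meromorphicContinuation_eventuallyEq (meromorphicOn_hermiteFormula ht)
    (hermiteFormula_halfPlane ht) (analyticAt_hermiteFormula ht hw)

theorem analyticAt_hurwitzZetaFunction (ht : 0 < t.re) {w : ℂ} (hw : w ≠ 1) :
    AnalyticAt ℂ (fun w => hurwitzZetaFunction w (t + 1 / 2)) w :=
  (analyticAt_hermiteFormula ht hw).congr (hurwitzZetaFunction_eventuallyEq ht hw).symm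

theorem exp_neg_one_sub_mul_log {k : ℕ} (hk : 1 ≤ k) {z : ℂ} (hz : 0 < z.re) :
    exp (-(1 - (k : ℂ)) * log z) = z ^ (k - 1) := by
  rw [show -(1 - (k : ℂ)) * log z = ((k - 1 : ℕ) : ℂ) * log z by
    rw [Nat.cast_sub hk]; push_cast; ring, exp_nat_mul, exp_log (by rintro rfl; simp at hz)]

theorem integrableOn_log_add_mul_I_mul_pow (ht : 0 < t.re) {k : ℕ} (hk : 1 ≤ k) :
    IntegrableOn (fun x : ℝ => log (t + x * I) * (t + x * I) ^ (k - 1) * fermiWeight 0 x)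
      (Ioi 0) := by
  refine (hasDerivAt_upperFermi ht (1 - k)).2.1.neg.congr (ae_of_all _ fun x => ?_)
  simp only [Pi.neg_apply]
  rw [exp_neg_one_sub_mul_log hk (by simpa using ht)]
  ring

theorem integrableOn_log_sub_mul_I_mul_pow (ht : 0 < t.re) {k : ℕ} (hk : 1 ≤ k) :
    IntegrableOn (fun x : ℝ => log (t - x * I) * (t - x * I) ^ (k - 1) * fermiWeight 0 x)
      (Ioi 0) := by
  refine (hasDerivAt_lowerFermi ht (1 - k)).2.1.neg.congr (ae_of_all _ fun x => ?_)
  simp only [Pi.neg_apply]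
  rw [exp_neg_one_sub_mul_log hk (by simpa using ht)]
  ring

/-- At w = 1-k the powers (t ± ix)^{-w} become polynomials of degree k-1, which lets the depths be
combined algebraically. -/
theorem logMilnorGamma_eq (ht : 0 < t.re) {k : ℕ} (hk : 1 ≤ k) :
    logMilnorGamma k (t + 1 / 2) = t ^ k * (log t / k - 1 / (k : ℂ) ^ 2) +
      I * ∫ x in Ioi (0 : ℝ), (log (t + x * I) * (t + x * I) ^ (k - 1) -
        log (t - x * I) * (t - x * I) ^ (k - 1)) * fermiWeight 0 x := by
  have hk0 : (k : ℂ) ≠ 0 := by exact_mod_cast (by omega : k ≠ 0)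
  have hne : (1 : ℂ) - k ≠ 1 := fun h => hk0 (by linear_combination -h)
  rw [logMilnorGamma, (hurwitzZetaFunction_eventuallyEq ht hne).deriv_eq]
  have e1 : HasDerivAt (fun w : ℂ => (1 - w) * log t) (-1 * log t) (1 - (k : ℂ)) :=
    ((hasDerivAt_id (1 - (k : ℂ))).const_sub 1).mul_const _
  have e2 : HasDerivAt (fun w : ℂ => w - 1) 1 (1 - (k : ℂ)) := (hasDerivAt_id _).sub_const _
  have e3 := e1.cexp.div e2 (sub_ne_zero.2 hne)
  have hL := hasDerivAt_lowerFermi ht (1 - k)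
  have hU := hasDerivAt_upperFermi ht (1 - k)
  have e4 := e3.add ((hL.2.2.sub hU.2.2).const_mul I)
  rw [← integral_sub hL.2.1 hU.2.1] at e4
  have e5 : deriv (hermiteFormula t) (1 - k) = _ := e4.deriv
  rw [e5]
  have ht0 : t ≠ 0 := by rintro rfl; simp at ht
  have e6 : exp ((1 - (1 - (k : ℂ))) * log t) = t ^ k := by
    rw [sub_sub_cancel, exp_nat_mul, exp_log ht0]
  rw [e6]
  congr 1
  · field_simp
    ring
  · congr 1
    refine integral_congr_ae (ae_of_all _ fun x => ?_)
    simp only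
    rw [exp_neg_one_sub_mul_log hk (by simpa using ht),
      exp_neg_one_sub_mul_log hk (by simpa using ht)]
    ring

end HurwitzZeta

/-! ### Binomial sums and the double factorials. -/

section Combinatorics

/-- The function y(1-y²)^{n+1} vanishes at 0 and 1; integrating its derivative gives the recursion
in n. -/
theorem integral_one_sub_sq_pow (n : ℕ) :
    ∫ y in (0 : ℝ)..1, (1 - y ^ 2) ^ n =
      ((2 * n).doubleFactorial : ℝ) / ((2 * n + 1).doubleFactorial : ℝ) := by
  induction n with
  | zero => simp [Nat.doubleFactorial]
  | succ n ih =>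
    have hd : ∀ y ∈ uIcc (0 : ℝ) 1, HasDerivAt (fun y : ℝ => y * (1 - y ^ 2) ^ (n + 1))
        ((2 * n + 3) * (1 - y ^ 2) ^ (n + 1) - (2 * n + 2) * (1 - y ^ 2) ^ n) y := by
      intro y _
      have h1 : HasDerivAt (fun y : ℝ => 1 - y ^ 2) (-(2 * y)) y := by
        simpa using (hasDerivAt_pow 2 y).const_sub 1
      refine ((hasDerivAt_id y).mul (h1.pow (n + 1))).congr_deriv ?_
      push_cast
      simp only [id, Pi.pow_apply]
      ring
    have h2 := intervalIntegral.integral_eq_sub_of_hasDerivAt hd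
      (Continuous.intervalIntegrable (by fun_prop) _ _)
    rw [intervalIntegral.integral_sub (Continuous.intervalIntegrable (by fun_prop) _ _)
      (Continuous.intervalIntegrable (by fun_prop) _ _), intervalIntegral.integral_const_mul,
      intervalIntegral.integral_const_mul, ih] at h2
    have e1 : (2 * (n + 1)).doubleFactorial = (2 * n + 2) * (2 * n).doubleFactorial :=
      Nat.doubleFactorial_add_two (2 * n)
    have e2 : (2 * (n + 1) + 1).doubleFactorial = (2 * n + 3) * (2 * n + 1).doubleFactorial :=
      Nat.doubleFactorial_add_two (2 * n + 1)
    have h3 : ((2 * n + 1).doubleFactorial : ℝ) ≠ 0 := by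
      exact_mod_cast (Nat.doubleFactorial_pos _).ne'
    have h4 : (2 * (n : ℝ) + 3) ≠ 0 := by positivity
    rw [e1, e2]
    push_cast
    rw [eq_div_iff (mul_ne_zero h4 h3)]
    simp only [one_pow, sub_self, ne_eq, Nat.add_eq_zero_iff, one_ne_zero, and_false,
      not_false_eq_true, zero_pow, mul_zero, zero_mul] at h2
    rw [mul_div_assoc', sub_eq_zero] at h2
    rw [← mul_assoc, mul_comm _ (2 * (n : ℝ) + 3), h2]
    field_simp

/-- Under x = 1-y the integrand becomes (1-y²)^n (1+y): the previous integral plus an elementary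
one. -/
theorem integral_pow_mul_two_sub_pow (n : ℕ) :
    ∫ x in (0 : ℝ)..1, x ^ n * (2 - x) ^ (n + 1) =
      ((2 * n).doubleFactorial : ℝ) / ((2 * n + 1).doubleFactorial : ℝ) + 1 / (2 * (n + 1)) := by
  have h1 := intervalIntegral.integral_comp_sub_left (a := 0) (b := 1)
    (fun x : ℝ => x ^ n * (2 - x) ^ (n + 1)) 1
  rw [sub_self, sub_zero] at h1
  have h2 : ∀ y : ℝ, (1 - y) ^ n * (2 - (1 - y)) ^ (n + 1) =
      (1 - y ^ 2) ^ n + y * (1 - y ^ 2) ^ n := by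
    intro y
    rw [show 1 - y ^ 2 = (1 - y) * (1 + y) by ring, mul_pow]
    ring
  have hd : ∀ y ∈ uIcc (0 : ℝ) 1, HasDerivAt
      (fun y : ℝ => -(1 - y ^ 2) ^ (n + 1) / (2 * (n + 1))) (y * (1 - y ^ 2) ^ n) y := by
    intro y _
    have h1 : HasDerivAt (fun y : ℝ => 1 - y ^ 2) (-(2 * y)) y := by
      simpa using (hasDerivAt_pow 2 y).const_sub 1
    refine ((h1.pow (n + 1)).neg.div_const (2 * ((n : ℝ) + 1))).congr_deriv ?_
    have : (n : ℝ) + 1 ≠ 0 := by positivity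
    push_cast
    field_simp
  rw [← h1]
  simp_rw [h2]
  rw [intervalIntegral.integral_add (Continuous.intervalIntegrable (by fun_prop) _ _)
      (Continuous.intervalIntegrable (by fun_prop) _ _), integral_one_sub_sq_pow,
      intervalIntegral.integral_eq_sub_of_hasDerivAt hd
      (Continuous.intervalIntegrable (by fun_prop) _ _)]
  simp [neg_div]

theorem sum_choose_mul_two_pow_div (n : ℕ) :
    ∑ j ∈ Finset.range (n + 2), ((n + 1).choose j : ℂ) * (-1) ^ j * 2 ^ (n + 1 - j) *
      (1 / ((n : ℂ) + 1 + j)) =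
      ((2 * n).doubleFactorial : ℂ) / ((2 * n + 1).doubleFactorial : ℂ) + 1 / (2 * (n + 1)) := by
  have h1 : ∀ x : ℝ, x ^ n * (2 - x) ^ (n + 1) = ∑ j ∈ Finset.range (n + 2),
      ((n + 1).choose j : ℝ) * (-1) ^ j * 2 ^ (n + 1 - j) * x ^ (n + j) := by
    intro x
    rw [show 2 - x = -x + 2 by ring, add_pow, Finset.mul_sum]
    refine Finset.sum_congr rfl fun j _ => ?_
    rw [neg_pow x, pow_add]
    ring
  have h2 := integral_pow_mul_two_sub_pow n
  simp_rw [h1] at h2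
  rw [intervalIntegral.integral_finsetSum fun j _ =>
    Continuous.intervalIntegrable (by fun_prop) _ _] at h2
  simp_rw [intervalIntegral.integral_const_mul, integral_pow] at h2
  have h3 := congrArg (fun x : ℝ => (x : ℂ)) h2
  push_cast at h3
  rw [← h3]
  refine Finset.sum_congr rfl fun j _ => ?_
  congr 1
  simp
  ring

/-- Both sides are the derivative in u of (u(c-u))^{n+1}, once expanded and once by the chain rule.
-/
theorem sum_choose_mul_pow (n : ℕ) (c u : ℂ) :
    ∑ j ∈ Finset.range (n + 2), ((n + 1).choose j : ℂ) * ((n : ℂ) + 1 + j) * (-1) ^ j *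
      c ^ (n + 1 - j) * u ^ (n + j) = (n + 1) * (u * (c - u)) ^ n * (c - 2 * u) := by
  have h1 : HasDerivAt (fun u : ℂ => ∑ j ∈ Finset.range (n + 2), ((n + 1).choose j : ℂ) *
      (-1) ^ j * c ^ (n + 1 - j) * u ^ (n + j + 1))
      (∑ j ∈ Finset.range (n + 2), ((n + 1).choose j : ℂ) * (-1) ^ j * c ^ (n + 1 - j) *
        ((n + j + 1 : ℕ) * u ^ (n + j))) u := by
    refine HasDerivAt.fun_sum fun j _ => ?_
    simpa using (hasDerivAt_pow (n + j + 1) u).const_mul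
      (((n + 1).choose j : ℂ) * (-1) ^ j * c ^ (n + 1 - j))
  have h2 : (fun u : ℂ => ∑ j ∈ Finset.range (n + 2), ((n + 1).choose j : ℂ) *
      (-1) ^ j * c ^ (n + 1 - j) * u ^ (n + j + 1)) = fun u => (u * (c - u)) ^ (n + 1) := by
    ext u
    rw [mul_pow, show c - u = -u + c by ring, add_pow, Finset.mul_sum]
    refine Finset.sum_congr rfl fun j _ => ?_
    rw [neg_pow u]
    ring
  have h3 : HasDerivAt (fun u : ℂ => (u * (c - u)) ^ (n + 1))
      ((n + 1) * (u * (c - u)) ^ n * (c - 2 * u)) u := by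
    have h4 : HasDerivAt (fun u : ℂ => u * (c - u)) (c - 2 * u) u :=
      ((hasDerivAt_id u).mul ((hasDerivAt_id u).const_sub c)).congr_deriv (by simp; ring)
    refine (h4.pow (n + 1)).congr_deriv ?_
    push_cast
    simp
  rw [h2] at h1
  rw [← h1.unique h3]
  refine Finset.sum_congr rfl fun j _ => ?_
  push_cast
  ring

end Combinatorics

/-! ### Combining the Milnor gamma functions and comparing exponents. -/

section Formula

/-- The exponent of the Milnor gamma function of depth `k`. -/
noncomputable def milnorExponent (r k : ℕ) (s : ℂ) : ℂ :=
  (r.choose (k - r) : ℂ) * (2 * (k : ℂ) / (r : ℂ)) * (-1) ^ (k + r - 1) * (2 * s - 1) ^ (2 * r - k)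

theorem milnorExponent_add (n j : ℕ) (t : ℂ) :
    milnorExponent (n + 1) (n + 1 + j) (t + 1 / 2) =
      -(2 / (n + 1)) * (((n + 1).choose j : ℂ) * ((n : ℂ) + 1 + j) * (-1) ^ j *
        (2 * t) ^ (n + 1 - j)) := by
  have h1 : (-1 : ℂ) ^ (n + 1 + j + (n + 1) - 1) = -(-1) ^ j := by
    rw [show n + 1 + j + (n + 1) - 1 = 2 * n + j + 1 by omega, pow_succ, pow_add, pow_mul]
    simp
  rw [milnorExponent, h1, Nat.add_sub_cancel_left,
    show 2 * (n + 1) - (n + 1 + j) = n + 1 - j by omega,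
    show 2 * (t + 1 / 2) - 1 = 2 * t by ring]
  push_cast
  ring

theorem sum_milnorExponent_mul (n : ℕ) (t : ℂ) (f : ℕ → ℂ) :
    ∑ k ∈ Finset.Icc (n + 1) (2 * (n + 1)), milnorExponent (n + 1) k (t + 1 / 2) * f k =
      -(2 / (n + 1)) * ∑ j ∈ Finset.range (n + 2), ((n + 1).choose j : ℂ) * ((n : ℂ) + 1 + j) *
        (-1) ^ j * (2 * t) ^ (n + 1 - j) * f (n + 1 + j) := by
  have h1 : Finset.Icc (n + 1) (2 * (n + 1)) = Finset.Ico (n + 1) (2 * (n + 1) + 1) := by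
    ext k; simp only [Finset.mem_Icc, Finset.mem_Ico]; omega
  rw [h1, Finset.sum_Ico_eq_sum_range, show 2 * (n + 1) + 1 - (n + 1) = n + 2 by omega,
    Finset.mul_sum]
  refine Finset.sum_congr rfl fun j _ => ?_
  rw [milnorExponent_add]
  ring

/-- The factor u(2t-u) is invariant under u ↦ 2t-u while u-t changes sign. This reflection swaps
t+ix and t-ix. -/
theorem sum_milnorExponent_mul_pow (n : ℕ) (t u : ℂ) :
    ∑ k ∈ Finset.Icc (n + 1) (2 * (n + 1)), milnorExponent (n + 1) k (t + 1 / 2) * u ^ (k - 1) =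
      4 * (u * (2 * t - u)) ^ n * (u - t) := by
  rw [sum_milnorExponent_mul n t fun k => u ^ (k - 1)]
  have h := sum_choose_mul_pow n (2 * t) u
  simp only [show ∀ j, n + 1 + j - 1 = n + j by intro j; omega]
  rw [h]
  have : (n : ℂ) + 1 ≠ 0 := Nat.cast_add_one_ne_zero n
  field_simp
  ring

/-- The factor k in the exponent cancels one k in each denominator. The log t terms then sum to
(2-1)^{n+1} = 1, and the others, now with 1/k, give the double factorials. -/
theorem sum_milnorExponent_mul_elementary (n : ℕ) (t : ℂ) :
    ∑ k ∈ Finset.Icc (n + 1) (2 * (n + 1)), milnorExponent (n + 1) k (t + 1 / 2) *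
      (t ^ k * (log t / k - 1 / (k : ℂ) ^ 2)) =
      t ^ (2 * (n + 1)) * (-(2 / (n + 1)) * log t + 1 / ((n : ℂ) + 1) ^ 2 +
        ((2 * (n + 1)).doubleFactorial : ℂ) /
          (((n : ℂ) + 1) ^ 2 * ((2 * (n + 1) - 1).doubleFactorial : ℂ))) := by
  rw [sum_milnorExponent_mul n t fun k => t ^ k * (log t / k - 1 / (k : ℂ) ^ 2)]
  have h1 : ∀ j ∈ Finset.range (n + 2), ((n + 1).choose j : ℂ) * ((n : ℂ) + 1 + j) *
      (-1) ^ j * (2 * t) ^ (n + 1 - j) *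
        (t ^ (n + 1 + j) * (log t / (n + 1 + j : ℕ) - 1 / ((n + 1 + j : ℕ) : ℂ) ^ 2)) =
      t ^ (2 * (n + 1)) * log t * ((-1) ^ j * 2 ^ (n + 1 - j) * ((n + 1).choose j : ℂ)) -
      t ^ (2 * (n + 1)) * (((n + 1).choose j : ℂ) * (-1) ^ j * 2 ^ (n + 1 - j) *
        (1 / ((n : ℂ) + 1 + j))) := by
    intro j hj
    have hj' : j ≤ n + 1 := by have := Finset.mem_range.1 hj; omega
    have h2 : t ^ (2 * (n + 1)) = t ^ (n + 1 - j) * t ^ (n + 1 + j) := by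
      rw [← pow_add]; congr 1; omega
    have h3 : (n : ℂ) + 1 + j ≠ 0 := by
      exact_mod_cast (by omega : n + 1 + j ≠ 0)
    rw [h2, mul_pow]
    push_cast
    field_simp
  rw [Finset.sum_congr rfl h1, Finset.sum_sub_distrib, ← Finset.mul_sum, ← Finset.mul_sum,
    sum_choose_mul_two_pow_div, ← add_pow]
  have e1 : (2 * (n + 1)).doubleFactorial = (2 * n + 2) * (2 * n).doubleFactorial :=
    Nat.doubleFactorial_add_two (2 * n)
  rw [e1, show 2 * (n + 1) - 1 = 2 * n + 1 by omega]
  have h3 : ((2 * n + 1).doubleFactorial : ℂ) ≠ 0 := by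
    exact_mod_cast (Nat.doubleFactorial_pos _).ne'
  have : (n : ℂ) + 1 ≠ 0 := Nat.cast_add_one_ne_zero n
  push_cast
  rw [show (-1 : ℂ) + 2 = 1 by norm_num, one_pow]
  field_simp
  ring

theorem sum_milnorExponent_mul_logMilnorGamma (n : ℕ) {t : ℂ} (ht : 0 < t.re) :
    ∑ k ∈ Finset.Icc (n + 1) (2 * (n + 1)), milnorExponent (n + 1) k (t + 1 / 2) *
      logMilnorGamma k (t + 1 / 2) =
      t ^ (2 * (n + 1)) * (-(2 / (n + 1)) * log t + 1 / ((n : ℂ) + 1) ^ 2 +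
        ((2 * (n + 1)).doubleFactorial : ℂ) /
          (((n : ℂ) + 1) ^ 2 * ((2 * (n + 1) - 1).doubleFactorial : ℂ))) -
      4 * ∫ x in Ioi (0 : ℝ), log ((x : ℂ) ^ 2 + t ^ 2) * ((x : ℂ) ^ 2 + t ^ 2) ^ n *
        fermiWeight 1 x := by
  have hk : ∀ k ∈ Finset.Icc (n + 1) (2 * (n + 1)), 1 ≤ k := fun k hk =>
    le_trans (by omega) (Finset.mem_Icc.1 hk).1
  rw [Finset.sum_congr rfl fun k hk' => by rw [logMilnorGamma_eq ht (hk k hk'), mul_add],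
    Finset.sum_add_distrib, sum_milnorExponent_mul_elementary, sub_eq_add_neg]
  congr 1
  simp_rw [mul_left_comm _ I]
  rw [← Finset.mul_sum]
  simp_rw [← integral_const_mul]
  rw [← integral_finsetSum]
  · rw [← integral_neg, ← integral_const_mul]
    refine integral_congr_ae (ae_of_all _ fun x => ?_)
    simp only
    -- Separating the two points lets the polynomial identity act on each. Its values there have
    -- opposite signs, so the difference of logarithms becomes a sum, log(x²+t²).
    have h1 : ∀ k : ℕ, milnorExponent (n + 1) k (t + 1 / 2) *
        ((log (t + x * I) * (t + x * I) ^ (k - 1) - log (t - x * I) * (t - x * I) ^ (k - 1)) *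
          fermiWeight 0 x) =
        milnorExponent (n + 1) k (t + 1 / 2) * (t + x * I) ^ (k - 1) *
          (log (t + x * I) * fermiWeight 0 x) -
        milnorExponent (n + 1) k (t + 1 / 2) * (t - x * I) ^ (k - 1) *
          (log (t - x * I) * fermiWeight 0 x) := fun k => by ring
    simp_rw [h1]
    rw [Finset.sum_sub_distrib, ← Finset.sum_mul, ← Finset.sum_mul, sum_milnorExponent_mul_pow,
      sum_milnorExponent_mul_pow, log_sq_add_sq ht]
    have e1 : (t + x * I) * (2 * t - (t + x * I)) = (x : ℂ) ^ 2 + t ^ 2 := by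
      linear_combination -(x : ℂ) ^ 2 * I_sq
    have e2 : (t - x * I) * (2 * t - (t - x * I)) = (x : ℂ) ^ 2 + t ^ 2 := by
      linear_combination -(x : ℂ) ^ 2 * I_sq
    have e3 : fermiWeight 1 x = x * fermiWeight 0 x := by
      simp [fermiWeight]
    rw [e1, e2, e3]
    linear_combination (4 * ((x : ℂ) ^ 2 + t ^ 2) ^ n * x * fermiWeight 0 x *
      (log (t + x * I) + log (t - x * I))) * I_sq
  · intro k hk'
    refine Integrable.const_mul ?_ _
    refine ((integrableOn_log_add_mul_I_mul_pow ht (hk k hk')).sub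
      (integrableOn_log_sub_mul_I_mul_pow ht (hk k hk'))).congr (ae_of_all _ fun x => ?_)
    simp only [Pi.sub_apply]
    ring

/-- Comparing the logarithms of both sides, the integrals and the terms in log t and 1/r² coincide;
the double factorial term is cancelled by the exponential prefactor. -/
theorem gammaFactor_eq (r : ℕ) (hr : 1 ≤ r) {s : ℂ} (hs : 1 / 2 < s.re) :
    gammaFactor r s =
      Complex.exp (-(((2 * r).doubleFactorial : ℂ) /
          ((r : ℂ) ^ 2 * ((2 * r - 1).doubleFactorial : ℂ))) * (s - 1 / 2) ^ (2 * r)) *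
      ∏ k ∈ Finset.Icc r (2 * r), expPow (logMilnorGamma k s) (milnorExponent r k s) := by
  obtain ⟨n, rfl⟩ : ∃ n, r = n + 1 := ⟨r - 1, by omega⟩
  obtain ⟨t, rfl⟩ : ∃ t, s = t + 1 / 2 := ⟨s - 1 / 2, by ring⟩
  have ht : 0 < t.re := by
    simp only [add_re, one_div, inv_re, re_ofNat, normSq_ofNat] at hs
    linarith
  simp only [gammaFactor, expPow, ← exp_sum]
  rw [← exp_add, add_sub_cancel_right, sum_milnorExponent_mul_logMilnorGamma n ht,
    sum_deriv_momentFunction ht (n + 1) (by omega)]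
  congr 1
  rw [Nat.add_sub_cancel]
  push_cast
  ring

end Formula

/-! ### The proposition and its analytic continuation. -/

theorem proposition3p4 (r : ℕ) (hr : 1 ≤ r) :
    -- the objects are well defined, and the formula holds, for `Re s > 1/2`
    (∀ s : ℂ, 1 / 2 < s.re →
      (∀ ℓ ∈ Finset.range r,
        (∀ w : ℂ, (((2 * ℓ + 1 : ℕ) : ℝ) + 1) / 2 < w.re →
          MeasureTheory.IntegrableOn (momentIntegrand (2 * ℓ + 1) w (s - 1 / 2))
            (Set.Ioi (0 : ℝ))) ∧
        IsMeromorphicContinuation (fun w => momentIntegral (2 * ℓ + 1) w (s - 1 / 2))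
          ((((2 * ℓ + 1 : ℕ) : ℝ) + 1) / 2)
          (fun w => momentFunction (2 * ℓ + 1) w (s - 1 / 2)) ∧
        AnalyticAt ℂ (fun w => momentFunction (2 * ℓ + 1) w (s - 1 / 2)) 0) ∧
      (∀ w : ℂ, 1 < w.re → Summable (fun n : ℕ => ((n : ℂ) + s) ^ (-w))) ∧
      IsMeromorphicContinuation (fun w => hurwitzSeries w s) 1
        (fun w => hurwitzZetaFunction w s) ∧
      (∀ k ∈ Finset.Icc r (2 * r),
        AnalyticAt ℂ (fun w => hurwitzZetaFunction w s) (1 - (k : ℂ))) ∧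
      gammaFactor r s =
        Complex.exp (-(((2 * r).doubleFactorial : ℂ) /
            ((r : ℂ) ^ 2 * ((2 * r - 1).doubleFactorial : ℂ))) * (s - 1 / 2) ^ (2 * r)) *
        ∏ k ∈ Finset.Icc r (2 * r),
          milnorGammaPow k s
            ((r.choose (k - r) : ℂ) * (2 * (k : ℂ) / (r : ℂ)) * (-1) ^ (k + r - 1) *
              (2 * s - 1) ^ (2 * r - k))) ∧
    -- the formula persists under analytic continuation
    (∀ (Ω : Set ℂ) (Φ : ℂ → ℂ) (L : ℕ → ℂ → ℂ),
      IsOpen Ω → IsPreconnected Ω → {s : ℂ | 1 / 2 < s.re} ⊆ Ω →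
      DifferentiableOn ℂ Φ Ω →
      (∀ s : ℂ, 1 / 2 < s.re → Φ s = gammaFactor r s) →
      (∀ k ∈ Finset.Icc r (2 * r), DifferentiableOn ℂ (L k) Ω) →
      (∀ k ∈ Finset.Icc r (2 * r), ∀ s : ℂ, 1 / 2 < s.re → L k s = logMilnorGamma k s) →
      ∀ s ∈ Ω, Φ s =
        Complex.exp (-(((2 * r).doubleFactorial : ℂ) /
            ((r : ℂ) ^ 2 * ((2 * r - 1).doubleFactorial : ℂ))) * (s - 1 / 2) ^ (2 * r)) *
        ∏ k ∈ Finset.Icc r (2 * r),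
          expPow (L k s)
            ((r.choose (k - r) : ℂ) * (2 * (k : ℂ) / (r : ℂ)) * (-1) ^ (k + r - 1) *
              (2 * s - 1) ^ (2 * r - k))) := by
  constructor
  · intro s hs
    have ht : 0 < (s - 1 / 2).re := by
      simp only [sub_re, one_div, inv_re, re_ofNat, normSq_ofNat]
      linarith
    have hst : s - 1 / 2 + 1 / 2 = s := sub_add_cancel s _
    refine ⟨fun ℓ _ => ⟨fun w hw => ?_, isMeromorphicContinuation_momentFunction ht ℓ,
      analyticAt_momentFunction ht ℓ⟩, fun w hw => ?_, ?_, fun k hk => ?_, gammaFactor_eq r hr hs⟩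
    · exact integrableOn_momentIntegrand ht ℓ (by push_cast at hw; linarith)
    · exact summable_hurwitzSeries hw (by linarith)
    · simpa only [hst] using isMeromorphicContinuation_hurwitzZetaFunction ht
    · have hk0 : (k : ℂ) ≠ 0 := by
        exact_mod_cast (by have := (Finset.mem_Icc.1 hk).1; omega : k ≠ 0)
      have := analyticAt_hurwitzZetaFunction ht (w := 1 - k) fun h => hk0 (by linear_combination -h)
      simpa only [hst] using this
  · intro Ω Φ L hΩ hpre hsub hΦ hΦeq hL hLeq s hs
    have h1 : AnalyticOnNhd ℂ Φ Ω := hΦ.analyticOnNhd hΩ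
    have h2 : AnalyticOnNhd ℂ (fun s => Complex.exp (-(((2 * r).doubleFactorial : ℂ) /
            ((r : ℂ) ^ 2 * ((2 * r - 1).doubleFactorial : ℂ))) * (s - 1 / 2) ^ (2 * r)) *
        ∏ k ∈ Finset.Icc r (2 * r), expPow (L k s) (milnorExponent r k s)) Ω := by
      refine DifferentiableOn.analyticOnNhd ?_ hΩ
      refine DifferentiableOn.mul (by fun_prop) (DifferentiableOn.fun_finsetProd fun k hk => ?_)
      unfold expPow milnorExponent
      exact (DifferentiableOn.mul (by fun_prop) (hL k hk)).cexp
    have h0 : (1 : ℂ) ∈ {s : ℂ | 1 / 2 < s.re} := by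
      simp only [mem_ofPred_eq, one_re]; norm_num
    -- Identity theorem on Ω with base point 1, an interior point of the half-plane where the
    -- formula is known.
    refine h1.eqOn_of_preconnected_of_eventuallyEq h2 hpre (hsub h0) ?_ hs
    filter_upwards [(isOpen_lt continuous_const continuous_re).mem_nhds h0] with z hz
    rw [hΦeq z hz, gammaFactor_eq r hr hz]
    congr 1
    exact Finset.prod_congr rfl fun k hk => by rw [hLeq k hk z hz]
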